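/- Boolean functions take values in $\{-1,1\}$, where $-1$ stands for "true" and $1$ for "false". A halfspace on $\{0,1\}^n$ is a function $f:\{0,1\}^n\to\{-1,1\}$ of the form $f(x)=\operatorname{sign}\bigl(\sum_{i=1}^n a_ix_i-\theta\bigr)$ with $a_1,\dots,a_n,\theta\in\mathbb R$. The threshold degree $\deg_\pm(h)$ of a function $h:\{0,1\}^m\to\{-1,1\}$ is the least degree of a real polynomial $p$ in $m$ variables such that $h(x)=\operatorname{sign}p(x)$ for all $x\in\{0,1\}^m$. (1) For $n=1,2,3,\dots$ let $D(n)$ be the maximum threshold degree of a function $x\mapsto f(x)\wedge g(x)$ on $\{0,1\}^n$, where $f,g:\{0,1\}^n\to\{-1,1\}$ are halfspaces (in the same variables). Then $D(n)=\Theta(n)$; that is, there are absolute constants $c,C>0$ with $cn\le D(n)\le Cn$ for all $n\ge1$. (2) There is an absolute constant $\alpha_0>0$ such that for every $\alpha\in(0,\alpha_0]$ there is $\beta_0=\beta_0(\alpha)>0$ such that for every $\beta\in(0,\beta_0]$ and every integer $n\ge1$ the following holds. Choose integers $w_1,\dots,w_n$ independently and uniformly at random from $\{0,1,\dots,2^{\lfloor\alpha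 n\rfloor+1}-1\}$, and define $f:\{0,1\}^{2n}\to\{-1,1\}$ by $$f(x)=\operatorname{sign}\Bigl(\tfrac12+\sum_{i=1}^n w_ix_i-2^{\lfloor\alpha n\rfloor+1}\sum_{i=n+1}^{2n}x_i\Bigr).$$ Then with probability at least $1-e^{-n/3}$ over the choice of $w_1,\dots,w_n$, $$\deg_\pm(f\wedge f)\ge\lfloor\beta n\rfloor,$$ where $f\wedge f$ denotes the function $(x,y)\mapsto f(x)\wedge f(y)$ on $\{0,1\}^{2n}\times\{0,1\}^{2n}$. -/

import Mathlib

/-- The Boolean hypercube `{0,1}^ι`. -/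
abbrev Cube (ι : Type) : Type := ι → Fin 2

/-- A vertex of the hypercube, viewed as a point of `ℝ^ι`. -/
def Cube.toReal {ι : Type} (x : Cube ι) : ι → ℝ := fun i => ((x i : ℕ) : ℝ)

/-- The polynomial `p` sign-represents `f`: `f(x) = sign p(x)` for every vertex `x`.
Boolean functions take their values in `{-1, 1}`, inside `SignType = {-1, 0, 1}`. -/
def SignRepresents {ι : Type} (p : MvPolynomial ι ℝ) (f : Cube ι → SignType) : Prop :=
  ∀ x : Cube ι, f x = SignType.sign (MvPolynomial.eval x.toReal p)

/-- The threshold degree: the least degree of a real polynomial that agrees with `f` in sign. -/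
noncomputable def thresholdDegree {ι : Type} (f : Cube ι → SignType) : ℕ :=
  sInf {d : ℕ | ∃ p : MvPolynomial ι ℝ, p.totalDegree = d ∧ SignRepresents p f}

/-- A halfspace: a function into `{-1, 1}` of the form `x ↦ sign (∑ aᵢ xᵢ - θ)`. -/
def IsHalfspace {ι : Type} [Fintype ι] (f : Cube ι → SignType) : Prop :=
  (∀ x, f x = -1 ∨ f x = 1) ∧
    ∃ (a : ι → ℝ) (θ : ℝ), ∀ x, f x = SignType.sign (∑ i, a i * x.toReal i - θ)

/-- Conjunction of truth values, where `-1` stands for true and `1` for false. -/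
def andSign (a b : SignType) : SignType := if a = -1 ∧ b = -1 then -1 else 1

/-- The intersection `x ↦ f(x) ∧ g(x)` of two functions of the same variables. -/
def andSame {ι : Type} (f g : Cube ι → SignType) : Cube ι → SignType :=
  fun x => andSign (f x) (g x)

/-- The conjunction `(x, y) ↦ f(x) ∧ g(y)` of two functions of disjoint sets of variables. -/
def andDisjoint {ι κ : Type} (f : Cube ι → SignType) (g : Cube κ → SignType) :
    Cube (ι ⊕ κ) → SignType :=
  fun z => andSign (f fun i => z (Sum.inl i)) (g fun j => z (Sum.inr j))

/-- The threshold degrees of the intersections of two halfspaces on `{0,1}^n`. -/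
def intersectionDegrees (n : ℕ) : Set ℕ :=
  {d | ∃ f g : Cube (Fin n) → SignType,
    IsHalfspace f ∧ IsHalfspace g ∧ d = thresholdDegree (andSame f g)}

/-- `D(n)`: the maximum threshold degree of the intersection of two halfspaces on `{0,1}^n`. -/
noncomputable def maxIntersectionDegree (n : ℕ) : ℕ := sSup (intersectionDegrees n)

/-- The function `sign (1/2 + ∑_{i ≤ n} wᵢ xᵢ - 2^(k+1) ∑_{n < i ≤ 2n} xᵢ)` on `{0,1}^(2n)`. -/
noncomputable def weightedHalfspace (n k : ℕ) (w : Fin n → Fin (2 ^ (k + 1))) :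
    Cube (Fin (n + n)) → SignType :=
  fun x => SignType.sign ((1 / 2 : ℝ)
    + ∑ i : Fin n, ((w i : ℕ) : ℝ) * x.toReal (Fin.castAdd n i)
    - 2 ^ (k + 1) * ∑ i : Fin n, x.toReal (Fin.natAdd n i))

/-- The threshold degree is the degree of an actual sign-representation. -/
theorem exists_signRepresents {ι : Type} [Fintype ι] (f : Cube ι → SignType) :
    ∃ p : MvPolynomial ι ℝ, p.totalDegree = thresholdDegree f ∧ SignRepresents p f := by
  classical
  suffices h : ∃ p : MvPolynomial ι ℝ, SignRepresents p f by
    obtain ⟨p, hp⟩ := h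
    exact Nat.sInf_mem
      (s := {d : ℕ | ∃ p : MvPolynomial ι ℝ, p.totalDegree = d ∧ SignRepresents p f})
      ⟨_, p, rfl, hp⟩
  refine ⟨∑ y : Cube ι, MvPolynomial.C ((f y : SignType) : ℝ) *
    ∏ i, (if y i = 1 then MvPolynomial.X i else 1 - MvPolynomial.X i), fun x => ?_⟩
  have key : ∀ y : Cube ι, (∏ i, MvPolynomial.eval x.toReal
      (if y i = 1 then MvPolynomial.X i else 1 - MvPolynomial.X i : MvPolynomial ι ℝ))
      = if y = x then 1 else 0 := by
    intro y
    have h2 : ∀ a b : Fin 2, (if a = 1 then ((b : ℕ) : ℝ) else 1 - ((b : ℕ) : ℝ))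
        = if a = b then 1 else 0 := by
      intro a b
      fin_cases a <;> fin_cases b <;> simp
    have h3 : ∀ i, MvPolynomial.eval x.toReal
        (if y i = 1 then MvPolynomial.X i else 1 - MvPolynomial.X i : MvPolynomial ι ℝ)
        = if y i = x i then 1 else 0 := by
      intro i
      rw [← h2, apply_ite (MvPolynomial.eval x.toReal)]
      simp [Cube.toReal]
    simp only [h3, Fintype.prod_ite_zero, funext_iff]
    simp
  simp only [map_sum, map_mul, map_prod, MvPolynomial.eval_C, key]
  simp only [mul_ite, mul_one, mul_zero, Finset.sum_ite_eq', Finset.mem_univ, if_true]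
  cases f x <;> simp

/-- The supremum in the definition of `D(n)` is an attained maximum. -/
theorem maxIntersectionDegree_isGreatest (n : ℕ) :
    IsGreatest (intersectionDegrees n) (maxIntersectionDegree n) := by
  have hfin : (intersectionDegrees n).Finite := by
    refine (Set.finite_range
      (fun q : (Cube (Fin n) → SignType) × (Cube (Fin n) → SignType) =>
        thresholdDegree (andSame q.1 q.2))).subset ?_
    rintro d ⟨f, g, -, -, rfl⟩
    exact ⟨(f, g), rfl⟩
  have hne : (intersectionDegrees n).Nonempty := by
    have h : IsHalfspace (fun _ : Cube (Fin n) => (1 : SignType)) :=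
      ⟨fun _ => Or.inr rfl, 0, -1, fun _ => by simp⟩
    exact ⟨_, _, _, h, h, rfl⟩
  exact ⟨Nat.sSup_mem hne hfin.bddAbove, fun d hd => le_csSup hfin.bddAbove hd⟩

/-! The lower bound reduces the conjunction to a question about two real variables. A real
polynomial of degree `d` satisfies `|Q(x)| ≈ |Q(-x)|` unless some root has modulus comparable to
`x`; along the scales `x = 3 ^ j` each root can spoil only boundedly many, so at most `8 * d` scales
are unbalanced (`card_not_balancedAt_le`). If a function of two variables, of degree `d` in each, is
negative exactly on the quadrant `u, v < 0`, then a product of its sum and its difference across `u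
↦ -u` is unbalanced in `v` at every scale where the function itself is balanced in `u`. Counting
pairs of scales bounds their number by `32 * d` (`scales_le_of_quadrant_sign`).

To reach two variables, put `M = 2 ^ (k + 1)`. For random weights, the subset sums modulo `M` are
nearly independent of every low-order Walsh character (a second moment bound and a union bound). By
duality, every residue class then carries a distribution which polynomials of degree `D` cannot tell
from the uniform one (`exists_weights_of_abs_sum_walsh_le`). Draw `x` from the class of `z`, then
draw the second half of the coordinates uniformly from the layer that makes the halfspace value
equal to `z`. Layer averages are polynomials in the layer index, so the expectation of a monomial of
degree at most `D` is a polynomial of degree at most `D` in `z` (`exists_level_functionals`).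
Applied to both blocks, this turns a sign-representation of degree `D` into a function with the
quadrant pattern on about `k / 2` scales, whence `k / 2 + 1 ≤ 32 * D`.

The bound on `D(n)` from below takes one good weight vector and embeds the two blocks into `n`
variables; the bound from above is multilinear reduction. -/

/-! ### Univariate polynomials at `x` and `-x` -/

open Polynomial in
theorem exists_multiset_abs_eval_eq (Q : ℝ[X]) :
    ∃ (a : ℝ) (R : Multiset ℂ), 0 ≤ a ∧ R.card ≤ Q.natDegree ∧
      ∀ x : ℝ, |Q.eval x| = a * (R.map fun z => ‖(x : ℂ) - z‖).prod := by
  set q : ℂ[X] := Q.map (algebraMap ℝ ℂ) with hq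
  refine ⟨‖q.leadingCoeff‖, q.roots, norm_nonneg _, ?_, fun x => ?_⟩
  · exact (card_roots' q).trans natDegree_map_le
  · have h1 : q.eval (x : ℂ) = ((Q.eval x : ℝ) : ℂ) := by
      rw [hq, eval_map_algebraMap, ← Complex.coe_algebraMap, aeval_algebraMap_apply]
      simp
    have h2 : q.eval (x : ℂ) = q.leadingCoeff * (q.roots.map fun z => (x : ℂ) - z).prod := by
      conv_lhs => rw [(IsAlgClosed.splits q).eq_prod_roots]
      simp [eval_multiset_prod, Multiset.map_map]
    have h3 : |Q.eval x| = ‖q.eval (x : ℂ)‖ := by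
      rw [h1, Complex.norm_real, Real.norm_eq_abs]
    rw [h3, h2, norm_mul]
    congr 1
    induction q.roots using Multiset.induction_on with
    | empty => simp
    | cons a s ih => simp [ih]

/-- The relative loss at scale `x` caused by a root of modulus `ρ`. -/
noncomputable def rootCost (x ρ : ℝ) : ℝ := 4 * (3 * x / (3 * x + ρ) - x / (x + ρ))

theorem rootCost_eq {x ρ : ℝ} (hx : 0 < x) (hρ : 0 ≤ ρ) :
    rootCost x ρ = 8 * x * ρ / ((3 * x + ρ) * (x + ρ)) := by
  have h1 : 3 * x + ρ ≠ 0 := by positivity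
  have h2 : x + ρ ≠ 0 := by positivity
  unfold rootCost
  field_simp
  ring

theorem rootCost_nonneg {x ρ : ℝ} (hx : 0 < x) (hρ : 0 ≤ ρ) : 0 ≤ rootCost x ρ := by
  rw [rootCost_eq hx hρ]
  positivity

/-- By the triangle inequalities the relative loss is at most `2 * min x ρ / (x + ρ)`. The factor 4
in `rootCost` is what makes the cost dominate this, with equality at `ρ = x`. -/
theorem one_sub_rootCost_mul_norm_add_le {x : ℝ} (hx : 0 < x) (z : ℂ) :
    (1 - rootCost x ‖z‖) * ‖(x : ℂ) + z‖ ≤ ‖(x : ℂ) - z‖ := by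
  have hρ := norm_nonneg z
  set ρ := ‖z‖ with hz
  have hxn : ‖(x : ℂ)‖ = x := by simp [abs_of_pos hx]
  have h1 : ‖(x : ℂ) + z‖ ≤ x + ρ := by
    have := norm_add_le (x : ℂ) z
    rwa [hxn] at this
  have h2 : |x - ρ| ≤ ‖(x : ℂ) - z‖ := by
    have := abs_norm_sub_norm_le (x : ℂ) z
    rwa [hxn] at this
  have h3 : (1 - rootCost x ρ) * (x + ρ) ≤ |x - ρ| := by
    have hs : rootCost x ρ * (x + ρ) = 8 * x * ρ / (3 * x + ρ) := by
      rw [rootCost_eq hx hρ]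
      field_simp
    have h4 : 2 * min x ρ ≤ 8 * x * ρ / (3 * x + ρ) := by
      rw [le_div_iff₀ (by positivity)]
      have ha := min_le_left x ρ
      have hb := min_le_right x ρ
      have h0 : 0 ≤ min x ρ := le_min hx.le hρ
      nlinarith
    have h5 : x + ρ - 2 * min x ρ = |x - ρ| := by
      rcases le_total x ρ with h | h
      · rw [min_eq_left h, abs_of_nonpos (by linarith)]; ring
      · rw [min_eq_right h, abs_of_nonneg (by linarith)]; ring
    nlinarith
  -- A cost above one makes the left side nonpositive and the bound trivial.
  by_cases h6 : 0 ≤ 1 - rootCost x ρ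
  · exact (mul_le_mul_of_nonneg_left h1 h6).trans (h3.trans h2)
  · exact (mul_nonpos_of_nonpos_of_nonneg (not_le.mp h6).le (norm_nonneg _)).trans (norm_nonneg _)

theorem one_sub_rootCost_mul_norm_sub_le {x : ℝ} (hx : 0 < x) (z : ℂ) :
    (1 - rootCost x ‖z‖) * ‖(x : ℂ) - z‖ ≤ ‖(x : ℂ) + z‖ := by
  simpa [sub_eq_add_neg] using one_sub_rootCost_mul_norm_add_le hx (-z)

/-- The Weierstrass inequality `∏ (1 - s) ≥ 1 - ∑ s`, which adds up the losses of the individual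
roots. -/
theorem one_sub_sum_mul_prod_le {ι : Type*} (R : Multiset ι) {s f g : ι → ℝ}
    (hs : ∀ z, 0 ≤ s z) (hf : ∀ z, 0 ≤ f z) (hg : ∀ z, 0 ≤ g z)
    (h : ∀ z, (1 - s z) * f z ≤ g z) (hR : (R.map s).sum ≤ 1) :
    (1 - (R.map s).sum) * (R.map f).prod ≤ (R.map g).prod := by
  induction R using Multiset.induction_on with
  | empty => simp
  | cons a R ih =>
    simp only [Multiset.map_cons, Multiset.sum_cons, Multiset.prod_cons] at hR ⊢
    have hS : 0 ≤ (R.map s).sum := Multiset.sum_nonneg (by simpa using fun z _ => hs z)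
    have hP : 0 ≤ (R.map f).prod := Multiset.prod_nonneg (by simpa using fun z _ => hf z)
    have ha := hs a
    have ih' := ih (by linarith)
    calc (1 - (s a + (R.map s).sum)) * (f a * (R.map f).prod)
        ≤ ((1 - s a) * (1 - (R.map s).sum)) * (f a * (R.map f).prod) := by
          refine mul_le_mul_of_nonneg_right ?_ (mul_nonneg (hf a) hP)
          nlinarith
      _ = ((1 - s a) * f a) * ((1 - (R.map s).sum) * (R.map f).prod) := by ring
      _ ≤ g a * (R.map g).prod := by
          refine mul_le_mul (h a) ih' (mul_nonneg (by linarith) hP) (hg a)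

/-- The cost is an increment of `t ↦ 4 * t / (t + ρ)` from `t = x` to `t = 3 * x`, so it telescopes
over powers of three, and that function stays between 0 and 4. -/
theorem sum_rootCost_le (m : ℕ) {ρ : ℝ} (hρ : 0 ≤ ρ) :
    ∑ j ∈ Finset.range m, rootCost (3 ^ j) ρ ≤ 4 := by
  have h : ∀ j : ℕ, rootCost (3 ^ j) ρ =
      4 * ((3 : ℝ) ^ (j + 1) / (3 ^ (j + 1) + ρ)) - 4 * ((3 : ℝ) ^ j / (3 ^ j + ρ)) := by
    intro j
    rw [rootCost, pow_succ, mul_comm ((3 : ℝ) ^ j) 3]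
    ring
  simp only [h]
  rw [Finset.sum_range_sub (fun j : ℕ => 4 * ((3 : ℝ) ^ j / (3 ^ j + ρ)))]
  have h1 : (3 : ℝ) ^ m / (3 ^ m + ρ) ≤ 1 := by
    rw [div_le_one (by positivity)]
    linarith
  have h2 : 0 ≤ (3 : ℝ) ^ 0 / (3 ^ 0 + ρ) := by positivity
  linarith

/-- A polynomial is balanced at `x` if its values at `x` and `-x` agree up to a factor of two. -/
def BalancedAt (Q : Polynomial ℝ) (x : ℝ) : Prop :=
  |Q.eval x| ≤ 2 * |Q.eval (-x)| ∧ |Q.eval (-x)| ≤ 2 * |Q.eval x|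

-- A scale of cost below `1 / 2` is balanced, and the costs of at most `d` roots over all scales sum
-- to at most `4 * d`.
open Classical in
theorem card_not_balancedAt_le (Q : Polynomial ℝ) {d : ℕ} (hd : Q.natDegree ≤ d) (m : ℕ) :
    ((Finset.range m).filter fun j => ¬ BalancedAt Q (3 ^ j)).card ≤ 8 * d := by
  obtain ⟨a, R, ha, hR, hQ⟩ := exists_multiset_abs_eval_eq Q
  set cost : ℕ → ℝ := fun j => (R.map fun z => rootCost (3 ^ j) ‖z‖).sum with hcost
  have hc0 : ∀ j, 0 ≤ cost j := fun j => Multiset.sum_nonneg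
    (by simpa using fun z _ => rootCost_nonneg (by positivity) (norm_nonneg z))
  have key : ∀ j, ¬ BalancedAt Q (3 ^ j) → 1 / 2 ≤ cost j := by
    intro j hj
    by_contra hlt
    push Not at hlt
    apply hj
    have hx : (0 : ℝ) < 3 ^ j := by positivity
    have hneg : |Q.eval (-(3 ^ j))| = a * (R.map fun z => ‖((3 ^ j : ℝ) : ℂ) + z‖).prod := by
      rw [hQ]
      congr 3
      funext z
      rw [← norm_neg]
      congr 1
      push_cast
      ring
    have hle : cost j ≤ 1 := by linarith
    have h1 := one_sub_sum_mul_prod_le R (fun z => rootCost_nonneg hx (norm_nonneg z))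
      (fun z => norm_nonneg _) (fun z => norm_nonneg _)
      (one_sub_rootCost_mul_norm_add_le hx) hle
    have h2 := one_sub_sum_mul_prod_le R (fun z => rootCost_nonneg hx (norm_nonneg z))
      (fun z => norm_nonneg _) (fun z => norm_nonneg _)
      (one_sub_rootCost_mul_norm_sub_le hx) hle
    change (1 - cost j) * _ ≤ _ at h1
    change (1 - cost j) * _ ≤ _ at h2
    rw [BalancedAt, hneg, hQ]
    set A := (R.map fun z => ‖((3 ^ j : ℝ) : ℂ) + z‖).prod with hA
    set B := (R.map fun z => ‖((3 ^ j : ℝ) : ℂ) - z‖).prod with hB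
    have hA0 : 0 ≤ A := Multiset.prod_nonneg (by simp)
    have hB0 : 0 ≤ B := Multiset.prod_nonneg (by simp)
    have h3 : A ≤ 2 * B := by nlinarith
    have h4 : B ≤ 2 * A := by nlinarith
    constructor <;> nlinarith
  have hsum : ∑ j ∈ Finset.range m, cost j ≤ 4 * d := by
    have h1 : ∑ j ∈ Finset.range m, cost j
        = (R.map fun z => ∑ j ∈ Finset.range m, rootCost (3 ^ j) ‖z‖).sum := by
      simp only [hcost]
      clear * -
      induction R using Multiset.induction_on with
      | empty => simp
      | cons a s ih => simp [Finset.sum_add_distrib, ih]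
    rw [h1]
    have h2 := Multiset.sum_le_card_nsmul
      (R.map fun z => ∑ j ∈ Finset.range m, rootCost (3 ^ j) ‖z‖) 4
      (by simpa using fun z _ => sum_rootCost_le m (norm_nonneg z))
    rw [Multiset.card_map, nsmul_eq_mul] at h2
    have h3 : (R.card : ℝ) ≤ d := by exact_mod_cast hR.trans hd
    linarith
  have hfin : (((Finset.range m).filter fun j => ¬ BalancedAt Q (3 ^ j)).card : ℝ) * (1 / 2)
      ≤ 4 * d := by
    refine le_trans ?_ hsum
    rw [← nsmul_eq_mul]
    refine (Finset.card_nsmul_le_sum _ cost _ fun j hj => key j (Finset.mem_filter.mp hj).2).trans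
      (Finset.sum_le_sum_of_subset_of_nonneg (Finset.filter_subset _ _) fun j _ _ => hc0 j)
  have : (((Finset.range m).filter fun j => ¬ BalancedAt Q (3 ^ j)).card : ℝ) ≤ 8 * d := by
    linarith
  exact_mod_cast this

/-! ### The quadrant sign pattern needs many scales -/

/-- The signed powers of three with exponent below `m`. -/
def signedPowers (m : ℕ) : Set ℝ := {u | ∃ j < m, u = 3 ^ j ∨ u = -3 ^ j}

open Classical in
/-- A bivariate function that is a polynomial of degree `d` in each variable separately and has the
sign pattern of an intersection of two half-lines lives on few scales. -/
theorem scales_le_of_quadrant_sign (m d : ℕ) (g : ℝ → ℝ → ℝ)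
    (hleft : ∀ v ∈ signedPowers m, ∃ Q : Polynomial ℝ, Q.natDegree ≤ d ∧
      ∀ u ∈ signedPowers m, g u v = Q.eval u)
    (hright : ∀ u ∈ signedPowers m, ∃ Q : Polynomial ℝ, Q.natDegree ≤ d ∧
      ∀ v ∈ signedPowers m, g u v = Q.eval v)
    (hneg : ∀ u ∈ signedPowers m, ∀ v ∈ signedPowers m, u < 0 → v < 0 → g u v < 0)
    (hpos : ∀ u ∈ signedPowers m, ∀ v ∈ signedPowers m, 0 < u ∨ 0 < v → 0 < g u v) :
    m ≤ 32 * d := by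
  choose! Q hQd hQ using hleft
  choose! T hTd hT using hright
  have memP : ∀ j < m, (3 : ℝ) ^ j ∈ signedPowers m := fun j hj => ⟨j, hj, Or.inl rfl⟩
  have memN : ∀ j < m, -(3 : ℝ) ^ j ∈ signedPowers m := fun j hj => ⟨j, hj, Or.inr rfl⟩
  -- With `a, b, c, e` the values of `g` at `(±3 ^ j, ±3 ^ i)` as named below, `G j` is `(a - b) *
  -- (c + e)` at `3 ^ i` and `(c - e) * (a + b)` at `-3 ^ i`. The former is small when `a ≈ b` and
  -- `c ≈ -e`, the latter has no cancellation.
  set G : ℕ → Polynomial ℝ := fun j =>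
    (T (3 ^ j) - T (-3 ^ j)) * (T (3 ^ j) + T (-3 ^ j)).comp (-Polynomial.X) with hG
  have hGd : ∀ j < m, (G j).natDegree ≤ 2 * d := by
    intro j hj
    have h1 := hTd _ (memP j hj)
    have h2 := hTd _ (memN j hj)
    have h3 := (Polynomial.natDegree_sub_le (T (3 ^ j)) (T (-3 ^ j))).trans (max_le h1 h2)
    have h4 := (Polynomial.natDegree_add_le (T (3 ^ j)) (T (-3 ^ j))).trans (max_le h1 h2)
    refine Polynomial.natDegree_mul_le.trans ?_
    rw [Polynomial.natDegree_comp, Polynomial.natDegree_neg, Polynomial.natDegree_X]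
    omega
  have hbad : ∀ i < m, ∀ j < m, ¬ BalancedAt (Q (3 ^ i)) (3 ^ j) ∨
      ¬ BalancedAt (Q (-3 ^ i)) (3 ^ j) ∨ ¬ BalancedAt (G j) (3 ^ i) := by
    intro i hi j hj
    by_contra hcon
    push Not at hcon
    obtain ⟨⟨b1, b2⟩, ⟨b3, b4⟩, ⟨-, b6⟩⟩ := hcon
    have hp : (0 : ℝ) < 3 ^ i := by positivity
    have hq : (0 : ℝ) < 3 ^ j := by positivity
    rw [← hQ _ (memP i hi) _ (memP j hj), ← hQ _ (memP i hi) _ (memN j hj)] at b1 b2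
    rw [← hQ _ (memN i hi) _ (memP j hj), ← hQ _ (memN i hi) _ (memN j hj)] at b3 b4
    simp only [hG, Polynomial.eval_mul, Polynomial.eval_sub, Polynomial.eval_add,
      Polynomial.eval_comp, Polynomial.eval_neg, Polynomial.eval_X, neg_neg] at b6
    rw [← hT _ (memP j hj) _ (memP i hi), ← hT _ (memP j hj) _ (memN i hi),
      ← hT _ (memN j hj) _ (memP i hi), ← hT _ (memN j hj) _ (memN i hi)] at b6
    have s1 := hpos _ (memP j hj) _ (memP i hi) (Or.inl hq)
    have s2 := hpos _ (memN j hj) _ (memP i hi) (Or.inr hp)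
    have s3 := hpos _ (memP j hj) _ (memN i hi) (Or.inl hq)
    have s4 := hneg _ (memN j hj) _ (memN i hi) (by linarith) (by linarith)
    generalize g (3 ^ j) (3 ^ i) = a at *
    generalize g (-3 ^ j) (3 ^ i) = b at *
    generalize g (3 ^ j) (-3 ^ i) = c at *
    generalize g (-3 ^ j) (-3 ^ i) = e at *
    rw [abs_of_pos s1, abs_of_pos s2] at b1 b2
    rw [abs_of_pos s3, abs_of_neg s4] at b3 b4
    rw [abs_mul, abs_mul, abs_of_pos (show 0 < c - e by linarith),
      abs_of_pos (show 0 < a + b by linarith)] at b6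
    -- A ratio within a factor of two gives the `1 / 3`; balance of `G j` would then need `1 ≤ 2 /
    -- 9`.
    have h1 : |a - b| ≤ (a + b) / 3 := abs_le.mpr ⟨by linarith, by linarith⟩
    have h2 : |c + e| ≤ (c - e) / 3 := abs_le.mpr ⟨by linarith, by linarith⟩
    have h3 := mul_le_mul h1 h2 (abs_nonneg _) (by linarith)
    have h4 : 0 < (c - e) * (a + b) := mul_pos (by linarith) (by linarith)
    nlinarith
  set S := (Finset.range m) ×ˢ (Finset.range m) with hS
  -- Each pair of scales lies in one of three bad sets; on a line, each bad set has at most 8 times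
  -- the degree many points, and `G j` has degree up to `2 * d`.
  have hcard : m * m ≤ (8 * d) * m + (8 * d) * m + (8 * (2 * d)) * m := by
    set F1 := S.filter fun q => ¬ BalancedAt (Q (3 ^ q.1)) (3 ^ q.2)
    set F2 := S.filter fun q => ¬ BalancedAt (Q (-3 ^ q.1)) (3 ^ q.2)
    set F3 := S.filter fun q => ¬ BalancedAt (G q.2) (3 ^ q.1)
    have hcov : S ⊆ F1 ∪ F2 ∪ F3 := by
      intro q hq
      have hq' := Finset.mem_product.mp hq
      simp only [Finset.mem_range] at hq'
      have := hbad q.1 hq'.1 q.2 hq'.2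
      simp only [F1, F2, F3, Finset.mem_union, Finset.mem_filter]
      tauto
    have h1 : F1.card ≤ (8 * d) * (Finset.range m).card := by
      refine Finset.card_le_mul_card_image_of_maps_to (f := Prod.fst) ?_ _ ?_
      · intro q hq
        exact (Finset.mem_product.mp (Finset.mem_filter.mp hq).1).1
      · intro i hi
        refine le_trans (Finset.card_le_card_of_injOn Prod.snd ?_ ?_)
          (card_not_balancedAt_le (Q (3 ^ i)) (hQd _ (memP i (Finset.mem_range.mp hi))) m)
        · rintro ⟨a, b⟩ hq
          simp [F1, hS] at hq ⊢
          obtain ⟨⟨⟨_, hb⟩, h⟩, rfl⟩ := hq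
          exact ⟨hb, h⟩
        · rintro ⟨a, b⟩ hq ⟨a', b'⟩ hq' h
          simp [F1] at hq hq' h ⊢
          exact ⟨hq.2.trans hq'.2.symm, h⟩
    have h2 : F2.card ≤ (8 * d) * (Finset.range m).card := by
      refine Finset.card_le_mul_card_image_of_maps_to (f := Prod.fst) ?_ _ ?_
      · intro q hq
        exact (Finset.mem_product.mp (Finset.mem_filter.mp hq).1).1
      · intro i hi
        refine le_trans (Finset.card_le_card_of_injOn Prod.snd ?_ ?_)
          (card_not_balancedAt_le (Q (-3 ^ i)) (hQd _ (memN i (Finset.mem_range.mp hi))) m)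
        · rintro ⟨a, b⟩ hq
          simp [F2, hS] at hq ⊢
          obtain ⟨⟨⟨_, hb⟩, h⟩, rfl⟩ := hq
          exact ⟨hb, h⟩
        · rintro ⟨a, b⟩ hq ⟨a', b'⟩ hq' h
          simp [F2] at hq hq' h ⊢
          exact ⟨hq.2.trans hq'.2.symm, h⟩
    have h3 : F3.card ≤ (8 * (2 * d)) * (Finset.range m).card := by
      refine Finset.card_le_mul_card_image_of_maps_to (f := Prod.snd) ?_ _ ?_
      · intro q hq
        exact (Finset.mem_product.mp (Finset.mem_filter.mp hq).1).2
      · intro j hj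
        refine le_trans (Finset.card_le_card_of_injOn Prod.fst ?_ ?_)
          (card_not_balancedAt_le (G j) (hGd j (Finset.mem_range.mp hj)) m)
        · rintro ⟨a, b⟩ hq
          simp [F3, hS] at hq ⊢
          obtain ⟨⟨⟨ha, _⟩, h⟩, rfl⟩ := hq
          exact ⟨ha, h⟩
        · rintro ⟨a, b⟩ hq ⟨a', b'⟩ hq' h
          simp [F3] at hq hq' h ⊢
          exact ⟨h, hq.2.trans hq'.2.symm⟩
    have h4 := Finset.card_le_card hcov
    have h5 := Finset.card_union_le (F1 ∪ F2) F3
    have h6 := Finset.card_union_le F1 F2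
    rw [Finset.card_range] at h1 h2 h3
    rw [hS, Finset.card_product, Finset.card_range] at h4
    omega
  by_contra hlt
  push Not at hlt
  nlinarith

/-! ### Walsh characters and distributions that fool low degree -/

/-- The Walsh character of the set `S`, as a function on the hypercube. -/
noncomputable def walsh {ι : Type} (S : Finset ι) (x : Cube ι) : ℝ := ∏ i ∈ S, (1 - 2 * x.toReal i)

theorem fin_two_eq_zero_or_one (a : Fin 2) : a = 0 ∨ a = 1 := by
  fin_cases a <;> simp

section Walsh

variable {ι : Type}

theorem Cube.toReal_mul_self (x : Cube ι) (i : ι) : x.toReal i * x.toReal i = x.toReal i := by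
  unfold Cube.toReal
  rcases fin_two_eq_zero_or_one (x i) with h | h <;> simp [h]

theorem walsh_empty (x : Cube ι) : walsh ∅ x = 1 := by simp [walsh]

theorem walsh_mul [Fintype ι] [DecidableEq ι] (S T : Finset ι) (x : Cube ι) :
    walsh S x * walsh T x = walsh (symmDiff S T) x := by
  have h : ∀ U : Finset ι, walsh U x = ∏ i, if i ∈ U then 1 - 2 * x.toReal i else 1 := fun U => by
    simp [walsh]
  rw [h, h, h, ← Finset.prod_mul_distrib]
  refine Finset.prod_congr rfl fun i _ => ?_
  have := x.toReal_mul_self i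
  by_cases hS : i ∈ S <;> by_cases hT : i ∈ T <;> simp [Finset.mem_symmDiff, hS, hT]
  linear_combination 4 * this

theorem walsh_mul_self [Fintype ι] [DecidableEq ι] (S : Finset ι) (x : Cube ι) :
    walsh S x * walsh S x = 1 := by
  rw [walsh_mul, symmDiff_self, Finset.bot_eq_empty, walsh_empty]

theorem abs_walsh [Fintype ι] (S : Finset ι) (x : Cube ι) : |walsh S x| = 1 := by
  classical
  have h := walsh_mul_self S x
  rw [← abs_mul_abs_self] at h
  nlinarith [abs_nonneg (walsh S x)]

theorem sum_walsh [Fintype ι] [DecidableEq ι] {S : Finset ι} (hS : S.Nonempty) :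
    ∑ x : Cube ι, walsh S x = 0 := by
  have h : ∀ x : Cube ι, walsh S x
      = ∏ i, if i ∈ S then 1 - 2 * (((x i : Fin 2) : ℕ) : ℝ) else 1 := fun x => by
    simp [walsh, Cube.toReal]
  simp only [h]
  rw [← Fintype.piFinset_univ, ← Finset.prod_univ_sum (fun _ => Finset.univ)
    (fun i (b : Fin 2) => if i ∈ S then 1 - 2 * ((b : ℕ) : ℝ) else 1)]
  obtain ⟨i, hi⟩ := hS
  refine Finset.prod_eq_zero (Finset.mem_univ i) ?_
  simp [hi]

/-- If all low-degree Walsh sums over `F` are small, then `F` carries a probability distribution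
that agrees with the uniform distribution of the hypercube on all low-degree characters. -/
theorem exists_weights_of_abs_sum_walsh_le [Fintype ι] [DecidableEq ι] (F : Finset (Cube ι))
    (D : ℕ) {lam : ℝ} (hlam : 0 ≤ lam)
    (h : ∀ S : Finset ι, S.Nonempty → S.card ≤ 2 * D → |∑ x ∈ F, walsh S x| ≤ lam)
    (hF : 2 * ((Finset.univ.filter fun S : Finset ι => S.card ≤ D).card : ℝ) * lam < F.card) :
    ∃ c : Cube ι → ℝ, (∀ x, 0 ≤ c x) ∧ (∀ x ∉ F, c x = 0) ∧ ∑ x, c x = 1 ∧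
      ∀ S : Finset ι, S.Nonempty → S.card ≤ D → ∑ x, c x * walsh S x = 0 := by
  let J := {S : Finset ι // S.Nonempty ∧ S.card ≤ D}
  let Φ : Cube ι → (J → ℝ) := fun x S => walsh S.1 x
  let L : (F → ℝ) →ₗ[ℝ] (J → ℝ) := Fintype.linearCombination ℝ fun x : F => Φ x
  -- The required distribution exists iff 0 is in the convex hull of the character vectors of points
  -- of `F`. Otherwise a separating functional is a combination of nonconstant low-order characters
  -- that is positive on `F`.
  have hmem : (0 : J → ℝ) ∈ L '' stdSimplex ℝ F := by
    by_contra hnot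
    obtain ⟨f, u, hu0, hu⟩ := geometric_hahn_banach_point_closed
      ((convex_stdSimplex ℝ F).linear_image L)
      ((isCompact_stdSimplex ℝ F).image L.continuous_of_finiteDimensional).isClosed hnot
    rw [map_zero] at hu0
    have hpos : ∀ x ∈ F, 0 < f (Φ x) := fun x hx =>
      hu0.trans (hu _ ⟨Pi.single ⟨x, hx⟩ 1, single_mem_stdSimplex ℝ _, by
        simp [L, Fintype.linearCombination_apply_single]⟩)
    set p : J → ℝ := fun S => f (Pi.single S 1) with hp
    have hf : ∀ x, f (Φ x) = ∑ S : J, p S * walsh S.1 x := by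
      intro x
      conv_lhs => rw [← Finset.univ_sum_single (Φ x)]
      rw [map_sum]
      refine Finset.sum_congr rfl fun S _ => ?_
      have : Pi.single S (Φ x S) = (walsh S.1 x) • (Pi.single S (1 : ℝ) : J → ℝ) := by
        rw [← Pi.single_smul]
        simp [Φ]
      rw [this, map_smul, smul_eq_mul, mul_comm]
    have hFne : F.Nonempty := by
      rw [← Finset.card_pos]
      have : (0 : ℝ) < F.card := lt_of_le_of_lt (by positivity) hF
      exact_mod_cast this
    have hJ : Nonempty J := by
      obtain ⟨x, hx⟩ := hFne
      by_contra hJ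
      rw [not_nonempty_iff] at hJ
      have := hpos x hx
      simp [hf] at this
    -- Testing the separator against the nonnegative weight `1 - σ * walsh T`, for its largest
    -- coefficient, gives a contradiction: the term `S = T` contributes about `-|p T| * F.card`, and
    -- all the rest is Walsh sums of order at most `2 * D`, too small to compensate.
    obtain ⟨T, hT⟩ := Finite.exists_max fun S => |p S|
    have hpT : 0 < |p T| := by
      obtain ⟨x, hx⟩ := hFne
      by_contra hcon
      have h0 : ∀ S, p S = 0 := fun S => abs_nonpos_iff.mp ((hT S).trans (not_lt.mp hcon))
      have := hpos x hx
      simp [hf, h0] at this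
    obtain ⟨σ, hσ1, hσ⟩ : ∃ σ : ℝ, |σ| = 1 ∧ p T * σ = |p T| := by
      rcases le_total 0 (p T) with h | h
      · exact ⟨1, by simp, by rw [abs_of_nonneg h, mul_one]⟩
      · exact ⟨-1, by simp, by rw [abs_of_nonpos h]; ring⟩
    have hge : 0 ≤ ∑ x ∈ F, f (Φ x) * (1 - σ * walsh T.1 x) := by
      refine Finset.sum_nonneg fun x hx => mul_nonneg (hpos x hx).le ?_
      have : |σ * walsh T.1 x| = 1 := by rw [abs_mul, hσ1, abs_walsh, one_mul]
      linarith [le_abs_self (σ * walsh T.1 x)]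
    have heq : ∑ x ∈ F, f (Φ x) * (1 - σ * walsh T.1 x) = ∑ S : J,
        p S * (∑ x ∈ F, walsh S.1 x - σ * ∑ x ∈ F, walsh (symmDiff S.1 T.1) x) := by
      simp only [hf, Finset.sum_mul]
      rw [Finset.sum_comm]
      refine Finset.sum_congr rfl fun S _ => ?_
      rw [Finset.mul_sum, ← Finset.sum_sub_distrib, Finset.mul_sum]
      refine Finset.sum_congr rfl fun x _ => ?_
      rw [← walsh_mul]
      ring
    have hterm : ∀ S : J,
        p S * (∑ x ∈ F, walsh S.1 x - σ * ∑ x ∈ F, walsh (symmDiff S.1 T.1) x)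
          ≤ |p T| * (2 * lam) - if S = T then |p T| * F.card else 0 := by
      intro S
      have h1 : |∑ x ∈ F, walsh S.1 x| ≤ lam := h S.1 S.2.1 (by have := S.2.2; omega)
      split_ifs with hST
      · subst hST
        simp only [symmDiff_self, Finset.bot_eq_empty, walsh_empty, Finset.sum_const, nsmul_eq_mul,
          mul_one]
        have h2 : p S * ∑ x ∈ F, walsh S.1 x ≤ |p S| * lam := by
          refine (le_abs_self _).trans ?_
          rw [abs_mul]
          exact mul_le_mul_of_nonneg_left h1 (abs_nonneg _)
        have h3 : p S * (∑ x ∈ F, walsh S.1 x - σ * F.card)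
          = p S * ∑ x ∈ F, walsh S.1 x - |p S| * F.card := by rw [← hσ]; ring
        rw [h3]
        nlinarith
      · have hne : (symmDiff S.1 T.1).Nonempty := by
          rw [Finset.nonempty_iff_ne_empty, ← Finset.bot_eq_empty, Ne, symmDiff_eq_bot]
          exact fun e => hST (Subtype.ext e)
        have hcard : (symmDiff S.1 T.1).card ≤ 2 * D := by
          have h2 : (symmDiff S.1 T.1).card ≤ S.1.card + T.1.card :=
            (Finset.card_le_card symmDiff_le_sup).trans (Finset.card_union_le _ _)
          have := S.2.2
          have := T.2.2
          omega
        have h2 := h _ hne hcard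
        have h3 : |∑ x ∈ F, walsh S.1 x - σ * ∑ x ∈ F, walsh (symmDiff S.1 T.1) x| ≤ 2 * lam := by
          refine (abs_sub _ _).trans ?_
          rw [abs_mul, hσ1]
          linarith
        rw [sub_zero]
        refine (le_abs_self _).trans ?_
        rw [abs_mul]
        exact mul_le_mul (hT S) h3 (abs_nonneg _) (abs_nonneg _)
    have hsum := Finset.sum_le_sum fun S (_ : S ∈ Finset.univ) => hterm S
    rw [← heq, Finset.sum_sub_distrib, Finset.sum_const, Finset.sum_ite_eq' Finset.univ T,
      if_pos (Finset.mem_univ _), nsmul_eq_mul] at hsum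
    have hJcard : ((Finset.univ : Finset J).card : ℝ)
        ≤ ((Finset.univ.filter fun S : Finset ι => S.card ≤ D).card : ℝ) := by
      norm_cast
      refine Finset.card_le_card_of_injOn (fun S => S.1) ?_ ?_
      · intro S _
        simpa using S.2.2
      · intro S _ S' _ e
        exact Subtype.ext e
    have h5 : ((Finset.univ : Finset J).card : ℝ) * lam
      ≤ ((Finset.univ.filter fun S : Finset ι => S.card ≤ D).card : ℝ) * lam :=
      mul_le_mul_of_nonneg_right hJcard hlam
    nlinarith
  obtain ⟨b, ⟨hb0, hb1⟩, hb⟩ := hmem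
  have hsum : ∀ h : Cube ι → ℝ,
      ∑ x, (if hx : x ∈ F then b ⟨x, hx⟩ else 0) * h x = ∑ x : F, b x * h x := by
    intro h
    rw [← Finset.sum_subset (Finset.subset_univ F) fun x _ hx => by simp [hx],
      ← Finset.sum_coe_sort F]
    simp
  refine ⟨fun x => if hx : x ∈ F then b ⟨x, hx⟩ else 0, fun x => ?_, fun x hx => by simp [hx],
    ?_, fun S hS hSD => ?_⟩
  · dsimp only
    split_ifs
    exacts [hb0 _, le_rfl]
  · have := hsum fun _ => 1
    simp only [mul_one] at this
    rw [this, hb1]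
  · rw [hsum]
    have := congrFun hb ⟨S, hS, hSD⟩
    simpa [L, Fintype.linearCombination_apply, Φ] using this

end Walsh

/-! ### Second moment of subset sums over random weights -/

section SecondMoment

variable {ι A : Type} [Fintype ι] [AddCommGroup A]

/-- The subset sum of the weights `w` selected by the vertex `x`. -/
def subsetSum (w : ι → A) (x : Cube ι) : A := ∑ i, (x i : ℕ) • w i

theorem subsetSum_add_single [DecidableEq ι] (w : ι → A) (x : Cube ι) (i : ι) (a : A) :
    subsetSum (w + Pi.single i a) x = subsetSum w x + (x i : ℕ) • a := by
  simp only [subsetSum, Pi.add_apply, smul_add, Finset.sum_add_distrib]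
  congr 1
  rw [Finset.sum_eq_single i] <;> simp +contextual

variable [Fintype A]

open Classical in
/-- The deviation of the event `subsetSum w x = z` from its expectation. -/
noncomputable def deviation (z : A) (w : ι → A) (x : Cube ι) : ℝ :=
  (if subsetSum w x = z then 1 else 0) - 1 / Fintype.card A

theorem abs_deviation_le (z : A) (w : ι → A) (x : Cube ι) : |deviation z w x| ≤ 1 := by
  have hA : (1 : ℝ) ≤ Fintype.card A := by
    exact_mod_cast Nat.one_le_iff_ne_zero.mpr Fintype.card_ne_zero
  have h1 : 1 / (Fintype.card A : ℝ) ≤ 1 := by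
    rw [div_le_one (by linarith)]; exact hA
  have h2 : 0 ≤ 1 / (Fintype.card A : ℝ) := by positivity
  unfold deviation
  split_ifs <;> rw [abs_le] <;> constructor <;> linarith

/-- Translating `w i` by a uniform group element leaves the subset sum at `y` fixed and makes the
one at `x` uniform, so the two deviations are uncorrelated. -/
theorem sum_deviation_mul_deviation [DecidableEq ι] (z : A) {x y : Cube ι} {i : ι} (hx : x i = 1)
    (hy : y i = 0) : ∑ w : ι → A, deviation z w x * deviation z w y = 0 := by
  classical
  have hA : (Fintype.card A : ℝ) ≠ 0 := by exact_mod_cast Fintype.card_ne_zero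
  have hshift : ∀ a : A, ∑ w : ι → A, deviation z w x * deviation z w y
      = ∑ w : ι → A, deviation z (w + Pi.single i a) x * deviation z (w + Pi.single i a) y :=
    fun a => (Equiv.sum_comp (Equiv.addRight (Pi.single i a : ι → A))
      (fun w => deviation z w x * deviation z w y)).symm
  have hyw : ∀ (a : A) (w : ι → A), deviation z (w + Pi.single i a) y = deviation z w y := by
    intro a w
    simp [deviation, subsetSum_add_single, hy]
  have hxw : ∀ w : ι → A, ∑ a : A, deviation z (w + Pi.single i a) x = 0 := by
    intro w
    simp only [deviation, subsetSum_add_single, hx, Finset.sum_sub_distrib]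
    have : ∀ a : A, subsetSum w x + ((1 : Fin 2) : ℕ) • a = z ↔ a = z - subsetSum w x := by
      intro a
      rw [eq_sub_iff_add_eq]
      simp [add_comm]
    simp only [this]
    simp [hA]
  have h : (Fintype.card A : ℝ) * ∑ w : ι → A, deviation z w x * deviation z w y = 0 := by
    calc (Fintype.card A : ℝ) * ∑ w : ι → A, deviation z w x * deviation z w y
        = ∑ a : A, ∑ w : ι → A, deviation z w x * deviation z w y := by
          simp
      _ = ∑ a : A, ∑ w : ι → A, deviation z (w + Pi.single i a) x * deviation z w y := by
          refine Finset.sum_congr rfl fun a _ => ?_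
          rw [hshift a]
          simp only [hyw]
      _ = 0 := by
          rw [Finset.sum_comm]
          simp only [← Finset.sum_mul, hxw, zero_mul, Finset.sum_const_zero]
  exact (mul_eq_zero.mp h).resolve_left hA

/-- Distinct vertices differ in a coordinate, so only the diagonal terms survive, each at most 1. -/
theorem sum_sq_sum_deviation_le [DecidableEq ι] (z : A) {s : Cube ι → ℝ} (hs : ∀ x, |s x| ≤ 1) :
    ∑ w : ι → A, (∑ x, s x * deviation z w x) ^ 2
      ≤ Fintype.card (ι → A) * Fintype.card (Cube ι) := by
  have hexp : ∀ w : ι → A, (∑ x, s x * deviation z w x) ^ 2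
      = ∑ x, ∑ y, s x * s y * (deviation z w x * deviation z w y) := by
    intro w
    rw [sq, Finset.sum_mul_sum]
    refine Finset.sum_congr rfl fun x _ => Finset.sum_congr rfl fun y _ => ?_
    ring
  simp only [hexp]
  rw [Finset.sum_comm]
  have hinner : ∀ x : Cube ι,
      ∑ w : ι → A, ∑ y, s x * s y * (deviation z w x * deviation z w y)
        ≤ Fintype.card (ι → A) := by
    intro x
    rw [Finset.sum_comm, Finset.sum_eq_single x]
    · have : ∀ w ∈ (Finset.univ : Finset (ι → A)),
          s x * s x * (deviation z w x * deviation z w x) ≤ 1 := by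
        intro w _
        have h1 := abs_le_one_iff_mul_self_le_one.mp (hs x)
        have h2 := abs_le_one_iff_mul_self_le_one.mp (abs_deviation_le z w x)
        exact mul_le_one₀ h1 (mul_self_nonneg _) h2
      simpa using Finset.sum_le_card_nsmul _ _ 1 this
    · intro y _ hyx
      rw [← Finset.mul_sum]
      obtain ⟨i, hi⟩ := Function.ne_iff.mp hyx
      have h0 : ∑ w : ι → A, deviation z w x * deviation z w y = 0 := by
        rcases fin_two_eq_zero_or_one (x i) with hx | hx <;>
          rcases fin_two_eq_zero_or_one (y i) with hy | hy
        · exact absurd (hy.trans hx.symm) hi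
        · rw [← sum_deviation_mul_deviation z hy hx]
          exact Finset.sum_congr rfl fun w _ => mul_comm _ _
        · exact sum_deviation_mul_deviation z hx hy
        · exact absurd (hy.trans hx.symm) hi
      rw [h0, mul_zero]
    · simp
  calc _ ≤ ∑ x : Cube ι, (Fintype.card (ι → A) : ℝ) := Finset.sum_le_sum fun x _ => hinner x
    _ = _ := by rw [Finset.sum_const, nsmul_eq_mul, mul_comm]; rfl

open Classical in
theorem card_lt_abs_sum_deviation_le [DecidableEq ι] (z : A) {s : Cube ι → ℝ}
    (hs : ∀ x, |s x| ≤ 1) {lam : ℝ} (hlam : 0 ≤ lam) :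
    ((Finset.univ.filter fun w : ι → A => lam < |∑ x, s x * deviation z w x|).card : ℝ) * lam ^ 2
      ≤ Fintype.card (ι → A) * Fintype.card (Cube ι) := by
  refine le_trans ?_ (sum_sq_sum_deviation_le z hs)
  rw [← nsmul_eq_mul]
  refine (Finset.card_nsmul_le_sum _ (fun w : ι → A => (∑ x, s x * deviation z w x) ^ 2) _
    fun w hw => ?_).trans (Finset.sum_le_sum_of_subset_of_nonneg (Finset.filter_subset _ _)
      fun w _ _ => sq_nonneg _)
  rw [← sq_abs (∑ x, s x * deviation z w x)]
  exact pow_le_pow_left₀ hlam (Finset.mem_filter.mp hw).2.le 2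

end SecondMoment

/-! ### From Walsh characters to all low-degree polynomials -/

theorem Cube.toReal_pow {ι : Type} (x : Cube ι) (i : ι) {k : ℕ} (hk : k ≠ 0) :
    x.toReal i ^ k = x.toReal i := by
  obtain ⟨k, rfl⟩ := Nat.exists_eq_succ_of_ne_zero hk
  rcases fin_two_eq_zero_or_one (x i) with h | h <;> simp [Cube.toReal, h]

theorem prod_toReal_eq_sum_walsh {ι : Type} [DecidableEq ι] (U : Finset ι) (x : Cube ι) :
    ∏ i ∈ U, x.toReal i
      = ∑ S ∈ U.powerset, ((-1 / 2) ^ S.card * (1 / 2) ^ (U \ S).card) * walsh S x := by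
  have h : ∀ i, x.toReal i = -1 / 2 * (1 - 2 * x.toReal i) + 1 / 2 := fun i => by ring
  rw [Finset.prod_congr rfl fun i _ => h i, Finset.prod_add]
  refine Finset.sum_congr rfl fun S _ => ?_
  rw [Finset.prod_mul_distrib, Finset.prod_const, Finset.prod_const, walsh]
  ring

section MatchesUniform

variable {ι : Type} [Fintype ι] [DecidableEq ι]

/-- The weights `c` have the same mean as the uniform distribution of the hypercube on every
polynomial of total degree at most `D`. -/
def MatchesUniform (c : Cube ι → ℝ) (D : ℕ) : Prop :=
  ∀ p : MvPolynomial ι ℝ, p.totalDegree ≤ D →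
    ∑ x, c x * MvPolynomial.eval x.toReal p
      = (∑ x : Cube ι, MvPolynomial.eval x.toReal p) / Fintype.card (Cube ι)

/-- On the cube every monomial is multilinear, and it expands in the characters of subsets of its
variables, so the order never exceeds the degree. -/
theorem matchesUniform_of_walsh {c : Cube ι → ℝ} {D : ℕ} (h1 : ∑ x, c x = 1)
    (h : ∀ S : Finset ι, S.Nonempty → S.card ≤ D → ∑ x, c x * walsh S x = 0) :
    MatchesUniform c D := by
  have hcard : (Fintype.card (Cube ι) : ℝ) ≠ 0 := by exact_mod_cast Fintype.card_ne_zero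
  have hwalsh : ∀ S : Finset ι, S.card ≤ D →
      ∑ x, c x * walsh S x = ∑ x : Cube ι, 1 / (Fintype.card (Cube ι) : ℝ) * walsh S x := by
    intro S hS
    rcases S.eq_empty_or_nonempty with rfl | hne
    · simp only [walsh_empty, mul_one, h1, Finset.sum_const, Finset.card_univ, nsmul_eq_mul]
      field_simp
    · rw [h S hne hS, ← Finset.mul_sum, sum_walsh hne, mul_zero]
  have hprod : ∀ U : Finset ι, U.card ≤ D → ∑ x, c x * ∏ i ∈ U, x.toReal i
      = ∑ x : Cube ι, 1 / (Fintype.card (Cube ι) : ℝ) * ∏ i ∈ U, x.toReal i := by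
    intro U hU
    have hexp : ∀ b : Cube ι → ℝ, ∑ x, b x * ∏ i ∈ U, x.toReal i = ∑ S ∈ U.powerset,
        ((-1 / 2) ^ S.card * (1 / 2) ^ (U \ S).card) * ∑ x, b x * walsh S x := by
      intro b
      simp only [prod_toReal_eq_sum_walsh, Finset.mul_sum]
      rw [Finset.sum_comm]
      refine Finset.sum_congr rfl fun S _ => Finset.sum_congr rfl fun x _ => ?_
      ring
    rw [hexp, hexp]
    refine Finset.sum_congr rfl fun S hS => ?_
    rw [hwalsh S ((Finset.card_le_card (Finset.mem_powerset.mp hS)).trans hU)]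
  intro p hp
  have hexp : ∀ b : Cube ι → ℝ, ∑ x, b x * MvPolynomial.eval x.toReal p
      = ∑ s ∈ p.support, p.coeff s * ∑ x, b x * ∏ i ∈ s.support, x.toReal i := by
    intro b
    simp only [MvPolynomial.eval_eq, Finset.mul_sum]
    rw [Finset.sum_comm]
    refine Finset.sum_congr rfl fun s _ => Finset.sum_congr rfl fun x _ => ?_
    rw [Finset.prod_congr rfl fun i hi => x.toReal_pow i (Finsupp.mem_support_iff.mp hi)]
    ring
  have hdeg : ∀ s ∈ p.support, s.support.card ≤ D := by
    intro s hs
    refine le_trans ?_ ((MvPolynomial.le_totalDegree hs).trans hp)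
    rw [Finset.card_eq_sum_ones]
    exact Finset.sum_le_sum fun i hi => Nat.one_le_iff_ne_zero.mpr (Finsupp.mem_support_iff.mp hi)
  have hmain : ∑ x, c x * MvPolynomial.eval x.toReal p
      = ∑ x : Cube ι, 1 / (Fintype.card (Cube ι) : ℝ) * MvPolynomial.eval x.toReal p := by
    rw [hexp, hexp]
    exact Finset.sum_congr rfl fun s hs => by rw [hprod _ (hdeg s hs)]
  rw [hmain, ← Finset.mul_sum]
  ring

end MatchesUniform

/-! ### Averages over layers of the hypercube -/

section Layers

open Classical in
/-- The vertex of the hypercube with support `Y`. -/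
noncomputable def indicatorVertex {κ : Type} (Y : Finset κ) : Cube κ :=
  fun i => if i ∈ Y then 1 else 0

theorem prod_toReal_indicatorVertex {κ : Type} [DecidableEq κ] (T Y : Finset κ) :
    ∏ i ∈ T, (indicatorVertex Y).toReal i = if T ⊆ Y then 1 else 0 := by
  split_ifs with h
  · exact Finset.prod_eq_one fun i hi => by simp [Cube.toReal, indicatorVertex, h hi]
  · obtain ⟨i, hi, hiY⟩ := Finset.not_subset.mp h
    exact Finset.prod_eq_zero hi (by simp [Cube.toReal, indicatorVertex, hiY])

theorem card_powersetCard_filter_superset {κ : Type} [Fintype κ] [DecidableEq κ] (T : Finset κ)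
    {t : ℕ} (ht : T.card ≤ t) :
    ((Finset.powersetCard t Finset.univ).filter fun Y : Finset κ => T ⊆ Y).card
      = (Fintype.card κ - T.card).choose (t - T.card) := by
  rw [← Finset.card_compl, ← Finset.card_powersetCard]
  refine Finset.card_nbij' (fun Y => Y \ T) (fun Z => Z ∪ T) ?_ ?_ ?_ ?_
  · intro Y hY
    simp only [Finset.coe_filter, Finset.mem_powersetCard, Set.mem_ofPred_eq] at hY
    simp only [Finset.mem_coe, Finset.mem_powersetCard]
    refine ⟨fun i hi => by simpa using (Finset.mem_sdiff.mp hi).2, ?_⟩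
    rw [Finset.card_sdiff_of_subset hY.2, hY.1.2]
  · intro Z hZ
    simp only [Finset.mem_coe, Finset.mem_powersetCard] at hZ
    simp only [Finset.coe_filter, Finset.mem_powersetCard, Set.mem_ofPred_eq]
    refine ⟨⟨Finset.subset_univ _, ?_⟩, Finset.subset_union_right⟩
    rw [Finset.card_union_of_disjoint, hZ.2]
    · omega
    · exact Finset.disjoint_left.mpr fun i hi => by simpa using hZ.1 hi
  · intro Y hY
    simp only [Finset.coe_filter, Finset.mem_powersetCard, Set.mem_ofPred_eq] at hY
    exact Finset.sdiff_union_of_subset hY.2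
  · intro Z hZ
    simp only [Finset.mem_coe, Finset.mem_powersetCard] at hZ
    exact Finset.union_sdiff_cancel_right
      (Finset.disjoint_left.mpr fun i hi => by simpa using hZ.1 hi)

/-- Averages of multilinear monomials over the layers of the hypercube are polynomials in the
index of the layer. -/
theorem exists_polynomial_layer_average {κ : Type} [Fintype κ] [DecidableEq κ] (T : Finset κ) :
    ∃ q : Polynomial ℝ, q.natDegree ≤ T.card ∧ ∀ t ≤ Fintype.card κ,
      ∑ Y ∈ Finset.powersetCard t Finset.univ,
        1 / ((Fintype.card κ).choose t : ℝ) * ∏ i ∈ T, (indicatorVertex Y).toReal i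
          = q.eval (t : ℝ) := by
  refine ⟨Polynomial.C (1 / ((T.card.factorial : ℝ) * (Fintype.card κ).choose T.card)) *
    descPochhammer ℝ T.card, ?_, fun t ht => ?_⟩
  · refine (Polynomial.natDegree_C_mul_le _ _).trans ?_
    rw [descPochhammer_natDegree]
  · have hn : 0 < (Fintype.card κ).choose t := Nat.choose_pos ht
    have hT : 0 < (Fintype.card κ).choose T.card := Nat.choose_pos T.card_le_univ
    have hn' : ((Fintype.card κ).choose t : ℝ) ≠ 0 := by exact_mod_cast hn.ne'
    have hT' : ((Fintype.card κ).choose T.card : ℝ) ≠ 0 := by exact_mod_cast hT.ne'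
    have hf : (T.card.factorial : ℝ) ≠ 0 := by exact_mod_cast T.card.factorial_ne_zero
    have hch := Nat.cast_choose_eq_descPochhammer_div ℝ t T.card
    rw [eq_div_iff hf] at hch
    rw [Polynomial.eval_mul, Polynomial.eval_C, ← hch, ← Finset.mul_sum]
    simp only [prod_toReal_indicatorVertex]
    rw [Finset.sum_boole]
    -- The identity `C(n,k) * C(n-k,t-k) = C(n,t) * C(t,k)` with `k = T.card`. For `t < k` both
    -- sides vanish, so one polynomial serves all layers.
    have hkey : (((Finset.powersetCard t Finset.univ).filter fun Y : Finset κ => T ⊆ Y).card : ℝ)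
        * (Fintype.card κ).choose T.card = (Fintype.card κ).choose t * t.choose T.card := by
      rcases le_or_gt T.card t with h | h
      · rw [card_powersetCard_filter_superset T h]
        have := Nat.choose_mul (n := Fintype.card κ) h
        rw [mul_comm]
        exact_mod_cast this.symm
      · rw [Nat.choose_eq_zero_of_lt h, Finset.filter_false_of_mem]
        · simp
        · intro Y hY hTY
          have := Finset.card_le_card hTY
          rw [(Finset.mem_powersetCard.mp hY).2] at this
          omega
    field_simp
    linarith

end Layers

theorem totalDegree_aeval_le {ι : Type} (q : Polynomial ℝ) {L : MvPolynomial ι ℝ}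
    (hL : L.totalDegree ≤ 1) : (Polynomial.aeval L q).totalDegree ≤ q.natDegree := by
  rw [Polynomial.aeval_eq_sum_range]
  refine (MvPolynomial.totalDegree_finsetSum _ _).trans (Finset.sup_le fun i hi => ?_)
  refine (MvPolynomial.totalDegree_smul_le _ _).trans ((MvPolynomial.totalDegree_pow _ _).trans ?_)
  have := Finset.mem_range.mp hi
  nlinarith

/-! ### Reducing the halfspace to its integer level -/

section Reduction

variable {n : ℕ}

/-- The integer whose sign the weighted halfspace computes, up to the shift by one half. -/
def halfspaceValue (w : Fin n → ℕ) (M : ℕ) (v : Cube (Fin (n + n))) : ℤ :=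
  ∑ i, (w i : ℤ) * (v (Fin.castAdd n i) : ℕ) - M * ∑ i, ((v (Fin.natAdd n i) : ℕ) : ℤ)

theorem weightedHalfspace_eq_ite (k : ℕ) (w : Fin n → Fin (2 ^ (k + 1))) (v : Cube (Fin (n + n))) :
    weightedHalfspace n k w v
      = if halfspaceValue (fun i => (w i : ℕ)) (2 ^ (k + 1)) v < 0 then -1 else 1 := by
  set h := halfspaceValue (fun i => (w i : ℕ)) (2 ^ (k + 1)) v with hh
  have hval : (1 / 2 : ℝ) + ∑ i : Fin n, ((w i : ℕ) : ℝ) * v.toReal (Fin.castAdd n i)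
      - 2 ^ (k + 1) * ∑ i : Fin n, v.toReal (Fin.natAdd n i) = (h : ℝ) + 1 / 2 := by
    rw [hh, halfspaceValue]
    push_cast
    simp only [Cube.toReal]
    ring
  rw [weightedHalfspace, hval]
  split_ifs with hneg
  · have : (h : ℝ) ≤ -1 := by exact_mod_cast Int.le_sub_one_of_lt hneg
    exact sign_neg (by linarith)
  · have : (0 : ℝ) ≤ h := by exact_mod_cast not_lt.mp hneg
    exact sign_pos (by linarith)

/-- If the residue classes of the subset sum carry distributions that low-degree polynomials cannot
tell apart, then the hypercube admits expectation functionals concentrated on the level sets of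
`halfspaceValue` under which low-degree monomials become univariate polynomials in the level. -/
theorem exists_level_functionals (hn : 0 < n) (w : Fin n → ℕ) {M : ℕ} (hM : 0 < M)
    (hw : ∀ i, w i < M) (D : ℕ)
    (c : ZMod M → Cube (Fin n) → ℝ) (hc0 : ∀ r x, 0 ≤ c r x)
    (hcsupp : ∀ r x, c r x ≠ 0 → subsetSum (fun i => (w i : ZMod M)) x = r)
    (hc1 : ∀ r, ∑ x, c r x = 1) (hc : ∀ r, MatchesUniform (c r) D) :
    ∃ N : ℤ → (Cube (Fin (n + n)) → ℝ) →ₗ[ℝ] ℝ,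
      (∀ z : ℤ, -M ≤ z → z < M → ∀ h : Cube (Fin (n + n)) → ℝ,
        (∀ v, halfspaceValue w M v = z → 0 < h v) → 0 < N z h) ∧
      ∀ a : Fin (n + n) → ℕ, ∑ i, a i ≤ D → ∃ H : Polynomial ℝ, H.natDegree ≤ D ∧
        ∀ z : ℤ, -M ≤ z → z < M → N z (fun v => ∏ i, v.toReal i ^ a i) = H.eval (z : ℝ) := by
  classical
  have hMR : (M : ℝ) ≠ 0 := by exact_mod_cast hM.ne'
  let σ : Cube (Fin n) → ℤ := fun x => ∑ i, (w i : ℤ) * (x i : ℕ)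
  -- The number of ones needed in the second half of the coordinates to bring the value from `σ x`
  -- down to `z`.
  let τ : ℤ → Cube (Fin n) → ℕ := fun z x => ((σ x - z) / M).toNat
  have hτ : ∀ z : ℤ, -M ≤ z → z < M → ∀ x, c z x ≠ 0 →
      τ z x ≤ n ∧ (M : ℤ) * τ z x = σ x - z := by
    intro z hz hzM x hx
    have h1 := hcsupp z x hx
    have h2 : ((σ x : ℤ) : ZMod M) = (z : ℤ) := by
      rw [← h1, subsetSum]
      simp only [σ]
      push_cast
      refine Finset.sum_congr rfl fun i _ => ?_
      rw [nsmul_eq_mul, mul_comm]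
    have h3 : (M : ℤ) ∣ σ x - z := by
      rw [← ZMod.intCast_zmod_eq_zero_iff_dvd, Int.cast_sub, h2, sub_self]
    obtain ⟨e, he⟩ := h3
    have hσ0 : 0 ≤ σ x := Finset.sum_nonneg fun i _ => by positivity
    have hσn : σ x ≤ n * (M - 1) := by
      calc σ x ≤ ∑ i : Fin n, ((M : ℤ) - 1) := by
            refine Finset.sum_le_sum fun i _ => ?_
            have h4 := hw i
            rcases fin_two_eq_zero_or_one (x i) with h5 | h5 <;> simp [h5] <;> omega
        _ = n * (M - 1) := by simp [mul_sub]
    have hM' : (0 : ℤ) < M := by exact_mod_cast hM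
    have he0 : 0 ≤ e := by
      by_contra hneg
      have : e ≤ -1 := by omega
      nlinarith
    have hen : e ≤ n := by
      by_contra hbig
      have h5 : (n : ℤ) + 1 ≤ e := by omega
      have h6 := mul_le_mul_of_nonneg_left h5 hM'.le
      have h7 : (1 : ℤ) ≤ n := by exact_mod_cast hn
      nlinarith
    have hτe : (τ z x : ℤ) = e := by
      simp only [τ]
      rw [he, Int.mul_ediv_cancel_left _ hM'.ne', Int.toNat_of_nonneg he0]
    refine ⟨?_, by rw [hτe, he]⟩
    omega
  -- Expectation over `x` drawn from `c z` and `Y` uniform in the layer `τ z x`.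
  let N : ℤ → (Cube (Fin (n + n)) → ℝ) →ₗ[ℝ] ℝ := fun z =>
    ∑ x : Cube (Fin n), ∑ Y ∈ Finset.powersetCard (τ z x) (Finset.univ : Finset (Fin n)),
      (c z x * (1 / (n.choose (τ z x) : ℝ))) •
        LinearMap.proj (R := ℝ) (φ := fun _ : Cube (Fin (n + n)) => ℝ)
          (Fin.append x (indicatorVertex Y) : Cube (Fin (n + n)))
  have hN : ∀ z h, N z h = ∑ x : Cube (Fin n),
      c z x * ∑ Y ∈ Finset.powersetCard (τ z x) (Finset.univ : Finset (Fin n)),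
        1 / (n.choose (τ z x) : ℝ) * h (Fin.append x (indicatorVertex Y)) := by
    intro z h
    simp [N, LinearMap.sum_apply, Finset.mul_sum, mul_assoc]
  refine ⟨N, ?_, ?_⟩
  · intro z hz hzM h hpos
    rw [hN]
    have hterm : ∀ x, c z x ≠ 0 →
        0 < ∑ Y ∈ Finset.powersetCard (τ z x) (Finset.univ : Finset (Fin n)),
          1 / (n.choose (τ z x) : ℝ) * h (Fin.append x (indicatorVertex Y)) := by
      intro x hx
      obtain ⟨h1, h2⟩ := hτ z hz hzM x hx
      refine Finset.sum_pos (fun Y hY => ?_) ?_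
      · refine mul_pos (one_div_pos.mpr (by exact_mod_cast Nat.choose_pos h1)) (hpos _ ?_)
        have hYcard := (Finset.mem_powersetCard.mp hY).2
        have h3 : ∑ i, (((indicatorVertex Y i : Fin 2) : ℕ) : ℤ) = τ z x := by
          have : ∀ i, (((indicatorVertex Y i : Fin 2) : ℕ) : ℤ) = if i ∈ Y then 1 else 0 := by
            intro i
            by_cases hi : i ∈ Y <;> simp [indicatorVertex, hi]
          simp [this, hYcard]
        simp only [halfspaceValue, Fin.append_left, Fin.append_right, h3]
        rw [h2]
        ring
      · exact Finset.powersetCard_nonempty.mpr (by simpa using h1)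
    obtain ⟨x, hx⟩ : ∃ x, c z x ≠ 0 := by
      by_contra hcon
      push Not at hcon
      have := hc1 z
      simp [hcon] at this
    refine Finset.sum_pos' (fun y _ => ?_)
      ⟨x, Finset.mem_univ _, mul_pos ((hc0 _ _).lt_of_ne' hx) (hterm x hx)⟩
    by_cases hy : c z y = 0
    · rw [hy, zero_mul]
    · exact mul_nonneg (hc0 _ _) (hterm y hy).le
  · intro a ha
    rw [Fin.sum_univ_add] at ha
    set T : Finset (Fin n) := Finset.univ.filter fun j => a (Fin.natAdd n j) ≠ 0 with hT
    obtain ⟨q, hqd, hq⟩ := exists_polynomial_layer_average T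
    have hTcard : T.card ≤ ∑ j, a (Fin.natAdd n j) := by
      rw [Finset.card_eq_sum_ones, hT, Finset.sum_filter]
      refine Finset.sum_le_sum fun j _ => ?_
      split_ifs <;> omega
    let m : Cube (Fin n) → ℝ := fun x => ∏ i, x.toReal i ^ a (Fin.castAdd n i)
    have hsplit : ∀ (x : Cube (Fin n)) (Y : Finset (Fin n)),
        ∏ i, Cube.toReal (Fin.append x (indicatorVertex Y)) i ^ a i
          = m x * ∏ j ∈ T, (indicatorVertex Y).toReal j := by
      intro x Y
      rw [Fin.prod_univ_add, hT, Finset.prod_filter]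
      congr 1
      · simp [m, Cube.toReal]
      · refine Finset.prod_congr rfl fun j _ => ?_
        split_ifs with hj
        · rw [← Cube.toReal_pow _ j hj]
          simp only [Cube.toReal, Fin.append_right]
        · push Not at hj
          rw [hj, pow_zero]
    have hσR : ∀ x, (σ x : ℝ) = ∑ i, (w i : ℝ) * x.toReal i := by
      intro x
      simp [σ, Cube.toReal]
    have hval : ∀ z : ℤ, -M ≤ z → z < M → N z (fun v => ∏ i, v.toReal i ^ a i)
        = ∑ x, c z x * (m x * q.eval (((σ x : ℝ) - z) / M)) := by
      intro z hz hzM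
      rw [hN]
      refine Finset.sum_congr rfl fun x _ => ?_
      by_cases hx : c z x = 0
      · rw [hx, zero_mul, zero_mul]
      · obtain ⟨h1, h2⟩ := hτ z hz hzM x hx
        congr 1
        have h3 : (τ z x : ℝ) = ((σ x : ℝ) - z) / M := by
          rw [eq_div_iff hMR, mul_comm]
          exact_mod_cast h2
        rw [← h3, ← hq _ (by simpa using h1), Finset.mul_sum, Fintype.card_fin]
        refine Finset.sum_congr rfl fun Y _ => ?_
        rw [hsplit]
        ring
    -- For fixed `z` the layer is affine in `x`, so the averaged monomial is a polynomial of degree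
    -- at most `D` in `x`. Replacing `c z` by the uniform distribution removes the only dependence
    -- on `z` that was not polynomial.
    have hmatch : ∀ z : ℤ, ∑ x, c z x * (m x * q.eval (((σ x : ℝ) - z) / M))
        = (∑ x, m x * q.eval (((σ x : ℝ) - z) / M)) / Fintype.card (Cube (Fin n)) := by
      intro z
      let L : MvPolynomial (Fin n) ℝ := MvPolynomial.C (1 / (M : ℝ)) *
        (∑ i, MvPolynomial.C (w i : ℝ) * MvPolynomial.X i - MvPolynomial.C (z : ℝ))
      have hL : L.totalDegree ≤ 1 := by
        refine (MvPolynomial.totalDegree_mul _ _).trans ?_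
        rw [MvPolynomial.totalDegree_C, zero_add]
        refine (MvPolynomial.totalDegree_sub _ _).trans (max_le ?_ (by
          rw [MvPolynomial.totalDegree_C]; exact zero_le_one))
        refine (MvPolynomial.totalDegree_finsetSum _ _).trans (Finset.sup_le fun i _ => ?_)
        refine (MvPolynomial.totalDegree_mul _ _).trans ?_
        rw [MvPolynomial.totalDegree_C, MvPolynomial.totalDegree_X]
      have hP := hc z ((∏ i, MvPolynomial.X i ^ a (Fin.castAdd n i)) * Polynomial.aeval L q) ?_
      · have heval : ∀ x : Cube (Fin n), MvPolynomial.eval x.toReal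
            ((∏ i, MvPolynomial.X i ^ a (Fin.castAdd n i)) * Polynomial.aeval L q)
            = m x * q.eval (((σ x : ℝ) - z) / M) := by
          intro x
          have h1 : MvPolynomial.eval x.toReal L = ((σ x : ℝ) - z) / M := by
            simp [L, hσR]
            ring
          rw [map_mul, ← h1]
          congr 1
          · simp [m]
          · rw [← MvPolynomial.coe_aeval_eq_eval, RingHom.coe_coe, ← Polynomial.aeval_algHom_apply]
            simp
        simpa only [heval] using hP
      · refine (MvPolynomial.totalDegree_mul _ _).trans ?_
        have h1 : (∏ i : Fin n, (MvPolynomial.X i : MvPolynomial (Fin n) ℝ)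
            ^ a (Fin.castAdd n i)).totalDegree ≤ ∑ i, a (Fin.castAdd n i) := by
          refine (MvPolynomial.totalDegree_finsetProd _ _).trans (Finset.sum_le_sum fun i _ => ?_)
          simp
        have h2 := totalDegree_aeval_le q hL
        omega
    refine ⟨Polynomial.C (1 / (Fintype.card (Cube (Fin n)) : ℝ)) * ∑ x, Polynomial.C (m x) *
      q.comp (Polynomial.C (1 / (M : ℝ)) * (Polynomial.C (σ x : ℝ) - Polynomial.X)), ?_, ?_⟩
    · refine (Polynomial.natDegree_C_mul_le _ _).trans ?_
      refine Polynomial.natDegree_sum_le_of_forall_le _ _ fun x _ => ?_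
      refine (Polynomial.natDegree_C_mul_le _ _).trans ?_
      rw [Polynomial.natDegree_comp]
      have h1 : (Polynomial.C (1 / (M : ℝ)) *
          (Polynomial.C (σ x : ℝ) - Polynomial.X)).natDegree ≤ 1 := by
        refine (Polynomial.natDegree_C_mul_le _ _).trans
          ((Polynomial.natDegree_sub_le _ _).trans ?_)
        simp
      calc _ ≤ q.natDegree * 1 := Nat.mul_le_mul_left _ h1
        _ ≤ D := by omega
    · intro z hz hzM
      rw [hval z hz hzM, hmatch]
      simp only [Polynomial.eval_mul, Polynomial.eval_C, Polynomial.eval_finsetSum,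
        Polynomial.eval_comp, Polynomial.eval_sub, Polynomial.eval_X]
      rw [div_eq_mul_one_div, mul_comm]
      congr 1
      refine Finset.sum_congr rfl fun x _ => ?_
      congr 2
      ring

end Reduction

/-! ### Equidistribution of random weights -/

section RandomWeights

variable {ι A : Type} [Fintype ι] [DecidableEq ι] [AddCommGroup A] [Fintype A]

/-- The subset sums of `w` are equidistributed, up to `lam`, against Walsh characters of order at
most `D`. -/
def WalshEquidistributed (w : ι → A) (D : ℕ) (lam : ℝ) : Prop :=
  ∀ (z : A) (S : Finset ι), S.card ≤ D → |∑ x, walsh S x * deviation z w x| ≤ lam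

-- Chebyshev's inequality for each target and each character, then a union bound.
open Classical in
theorem card_not_walshEquidistributed_le (D : ℕ) {lam : ℝ} (hlam : 0 ≤ lam) :
    ((Finset.univ.filter fun w : ι → A => ¬ WalshEquidistributed w D lam).card : ℝ) * lam ^ 2
      ≤ Fintype.card A * (Finset.univ.filter fun S : Finset ι => S.card ≤ D).card
        * (Fintype.card (ι → A) * Fintype.card (Cube ι)) := by
  set K := Finset.univ.filter fun S : Finset ι => S.card ≤ D
  set B : A × Finset ι → Finset (ι → A) := fun q =>
    Finset.univ.filter fun w : ι → A => lam < |∑ x, walsh q.2 x * deviation q.1 w x|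
  have hsub : (Finset.univ.filter fun w : ι → A => ¬ WalshEquidistributed w D lam)
      ⊆ (Finset.univ ×ˢ K).biUnion B := by
    intro w hw
    have h := (Finset.mem_filter.mp hw).2
    unfold WalshEquidistributed at h
    push Not at h
    obtain ⟨z, S, hS, hz⟩ := h
    exact Finset.mem_biUnion.mpr ⟨(z, S), by simp [K, hS], by simpa [B] using hz⟩
  have hcard : ((Finset.univ.filter fun w : ι → A => ¬ WalshEquidistributed w D lam).card : ℝ)
      ≤ ∑ q ∈ Finset.univ ×ˢ K, ((B q).card : ℝ) := by
    exact_mod_cast (Finset.card_le_card hsub).trans Finset.card_biUnion_le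
  calc _ ≤ (∑ q ∈ Finset.univ ×ˢ K, ((B q).card : ℝ)) * lam ^ 2 :=
        mul_le_mul_of_nonneg_right hcard (sq_nonneg _)
    _ ≤ ∑ q ∈ (Finset.univ : Finset A) ×ˢ K,
          (Fintype.card (ι → A) * Fintype.card (Cube ι) : ℝ) := by
        rw [Finset.sum_mul]
        refine Finset.sum_le_sum fun q _ => ?_
        exact card_lt_abs_sum_deviation_le q.1 (fun x => (abs_walsh q.2 x).le) hlam
    _ = _ := by
        rw [Finset.sum_const, Finset.card_product, nsmul_eq_mul]
        simp

theorem WalshEquidistributed.exists_weights {w : ι → A} {D : ℕ} {lam : ℝ} (hlam : 0 ≤ lam)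
    (h : WalshEquidistributed w (2 * D) lam)
    (hbig : (2 * ((Finset.univ.filter fun S : Finset ι => S.card ≤ D).card : ℝ) + 1) * lam
      < Fintype.card (Cube ι) / Fintype.card A) :
    ∃ c : A → Cube ι → ℝ, (∀ r x, 0 ≤ c r x) ∧ (∀ r x, c r x ≠ 0 → subsetSum w x = r) ∧
      (∀ r, ∑ x, c r x = 1) ∧ ∀ r, MatchesUniform (c r) D := by
  classical
  have key : ∀ r : A, ∃ c : Cube ι → ℝ, (∀ x, 0 ≤ c x) ∧ (∀ x, c x ≠ 0 → subsetSum w x = r) ∧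
      (∑ x, c x = 1) ∧ MatchesUniform c D := by
    intro r
    set F := Finset.univ.filter fun x : Cube ι => subsetSum w x = r with hF
    have hsum : ∀ S : Finset ι, ∑ x, walsh S x * deviation r w x
        = ∑ x ∈ F, walsh S x - 1 / Fintype.card A * ∑ x : Cube ι, walsh S x := by
      intro S
      rw [hF, Finset.sum_filter, Finset.mul_sum, ← Finset.sum_sub_distrib]
      refine Finset.sum_congr rfl fun x _ => ?_
      rw [deviation]
      split_ifs <;> ring
    obtain ⟨c, h0, h1, h2, h3⟩ := exists_weights_of_abs_sum_walsh_le F D hlam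
      (fun S hS hcard => by
        have := h r S hcard
        rwa [hsum, sum_walsh hS, mul_zero, sub_zero] at this) (by
        -- The empty character shows that the fibre has at least `2 ^ n / |A| - lam` points; the `+
        -- 1` in `hbig` absorbs this `lam`.
        have h4 := h r ∅ (by simp)
        rw [hsum] at h4
        simp only [walsh_empty, Finset.sum_const, nsmul_eq_mul, mul_one, Finset.card_univ] at h4
        have h5 := (abs_le.mp h4).1
        have h6 : 1 / (Fintype.card A : ℝ) * Fintype.card (Cube ι)
          = Fintype.card (Cube ι) / Fintype.card A := by ring
        linarith)
    refine ⟨c, h0, fun x hx => ?_, h2, matchesUniform_of_walsh h2 h3⟩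
    by_contra hne
    exact hx (h1 x (by simp [hF, hne]))
  choose c h0 h1 h2 h3 using key
  exact ⟨c, h0, h1, h2, h3⟩

end RandomWeights

/-! ### From a sign-representation to the quadrant pattern -/

/-- Powers of three are odd, so `u = 2 * z + 1` makes them levels `z`, with the threshold between -1
and 0 moved to the symmetric point `u = 0`. The bound `3 ^ j ≤ 4 ^ j ≤ 2 ^ k` keeps `z` in the
window. -/
theorem exists_int_of_mem_signedPowers (k : ℕ) :
    ∀ u ∈ signedPowers (k / 2 + 1),
    ∃ z : ℤ, u = 2 * z + 1 ∧ -((2 ^ (k + 1) : ℕ) : ℤ) ≤ z ∧ z < ((2 ^ (k + 1) : ℕ) : ℤ) := by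
  rintro u ⟨j, hj, hu⟩
  have h3 : 3 ^ j ≤ 2 ^ k := by
    calc 3 ^ j ≤ 4 ^ j := Nat.pow_le_pow_left (by norm_num) j
      _ = 2 ^ (2 * j) := by rw [pow_mul]; norm_num
      _ ≤ 2 ^ k := Nat.pow_le_pow_right (by norm_num) (by omega)
  obtain ⟨e, he⟩ : Odd (3 ^ j) := Odd.pow (by decide)
  have heR : (3 : ℝ) ^ j = 2 * e + 1 := by exact_mod_cast he
  have hk : 2 ^ (k + 1) = 2 * 2 ^ k := by ring
  rcases hu with rfl | rfl
  · exact ⟨e, by rw [heR]; push_cast; ring, by omega, by omega⟩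
  · exact ⟨-e - 1, by rw [heR]; push_cast; ring, by omega, by omega⟩

theorem scales_le_of_signRepresents {n k D : ℕ} (hn : 0 < n) (w : Fin n → Fin (2 ^ (k + 1)))
    (c : ZMod (2 ^ (k + 1)) → Cube (Fin n) → ℝ) (hc0 : ∀ r x, 0 ≤ c r x)
    (hcsupp : ∀ r x, c r x ≠ 0 →
      subsetSum (fun i => ((w i : ℕ) : ZMod (2 ^ (k + 1)))) x = r)
    (hc1 : ∀ r, ∑ x, c r x = 1) (hc : ∀ r, MatchesUniform (c r) D)
    (p : MvPolynomial (Fin (n + n) ⊕ Fin (n + n)) ℝ) (hp : p.totalDegree ≤ D)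
    (hsign : SignRepresents p
      (andDisjoint (weightedHalfspace n k w) (weightedHalfspace n k w))) :
    k / 2 + 1 ≤ 32 * D := by
  obtain ⟨N, hpos, hpoly⟩ := exists_level_functionals hn (fun i => (w i : ℕ))
    (by positivity : 0 < 2 ^ (k + 1)) (fun i => (w i).isLt) D c hc0 hcsupp hc1 hc
  choose! H hHd hH using hpoly
  choose! ζ hζ hζl hζu using exists_int_of_mem_signedPowers k
  let mon : (Fin (n + n) → ℕ) → Cube (Fin (n + n)) → ℝ := fun a v => ∏ i, v.toReal i ^ a i
  have heval : ∀ v₁ v₂ : Cube (Fin (n + n)),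
      MvPolynomial.eval (Cube.toReal (Sum.elim v₁ v₂)) p = ∑ s ∈ p.support,
        p.coeff s * (mon (fun i => s (Sum.inl i)) v₁ * mon (fun i => s (Sum.inr i)) v₂) := by
    intro v₁ v₂
    rw [MvPolynomial.eval_eq']
    refine Finset.sum_congr rfl fun s _ => ?_
    rw [Fintype.prod_sum_type]
    rfl
  have hdeg : ∀ s ∈ p.support, ∑ i, s (Sum.inl i) ≤ D ∧ ∑ i, s (Sum.inr i) ≤ D := by
    intro s hs
    have h1 := (MvPolynomial.le_totalDegree hs).trans hp
    rw [Finsupp.sum_fintype _ _ (fun _ => rfl), Fintype.sum_sum_type] at h1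
    omega
  -- The level functionals applied in both blocks. Positivity transfers the sign of `p` on a product
  -- of level sets to `P`, and linearity makes `P` a polynomial in each variable separately.
  let P : ℝ → ℝ → ℝ := fun u v =>
    N (ζ u) fun v₁ => N (ζ v) fun v₂ => MvPolynomial.eval (Cube.toReal (Sum.elim v₁ v₂)) p
  have hP : ∀ u v, P u v = ∑ s ∈ p.support, p.coeff s *
      (N (ζ u) (mon fun i => s (Sum.inl i)) * N (ζ v) (mon fun i => s (Sum.inr i))) := by
    intro u v
    have h1 : ∀ v₁, (N (ζ v) fun v₂ => MvPolynomial.eval (Cube.toReal (Sum.elim v₁ v₂)) p)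
        = ∑ s ∈ p.support, p.coeff s *
          (mon (fun i => s (Sum.inl i)) v₁ * N (ζ v) (mon fun i => s (Sum.inr i))) := by
      intro v₁
      have : (fun v₂ => MvPolynomial.eval (Cube.toReal (Sum.elim v₁ v₂)) p)
          = ∑ s ∈ p.support, (p.coeff s * mon (fun i => s (Sum.inl i)) v₁) •
            mon (fun i => s (Sum.inr i)) := by
        funext v₂
        rw [heval, Finset.sum_apply]
        simp [mul_assoc]
      rw [this, map_sum]
      simp [mul_assoc]
    have h2 : (fun v₁ => N (ζ v) fun v₂ => MvPolynomial.eval (Cube.toReal (Sum.elim v₁ v₂)) p)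
        = ∑ s ∈ p.support, (p.coeff s * N (ζ v) (mon fun i => s (Sum.inr i))) •
          mon (fun i => s (Sum.inl i)) := by
      funext v₁
      rw [h1, Finset.sum_apply]
      refine Finset.sum_congr rfl fun s _ => ?_
      rw [Pi.smul_apply, smul_eq_mul]
      ring
    simp only [P]
    rw [h2, map_sum]
    refine Finset.sum_congr rfl fun s _ => ?_
    rw [map_smul, smul_eq_mul]
    ring
  have hNH : ∀ u ∈ signedPowers (k / 2 + 1), ∀ a : Fin (n + n) → ℕ, ∑ i, a i ≤ D →
      N (ζ u) (mon a) = ((H a).comp (Polynomial.C (1 / 2) * (Polynomial.X - 1))).eval u := by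
    intro u hu a ha
    have h1 : (Polynomial.C (1 / 2 : ℝ) * (Polynomial.X - 1)).eval u = (ζ u : ℝ) := by
      conv_lhs => rw [hζ u hu]
      simp
    rw [Polynomial.eval_comp, h1]
    exact hH a ha _ (hζl u hu) (hζu u hu)
  have hcomp : ∀ a : Fin (n + n) → ℕ, ∑ i, a i ≤ D →
      ((H a).comp (Polynomial.C (1 / 2) * (Polynomial.X - 1))).natDegree ≤ D := by
    intro a ha
    rw [Polynomial.natDegree_comp]
    have h1 : (Polynomial.C (1 / 2 : ℝ) * (Polynomial.X - 1)).natDegree ≤ 1 := by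
      refine (Polynomial.natDegree_C_mul_le _ _).trans ((Polynomial.natDegree_sub_le _ _).trans ?_)
      simp
    calc _ ≤ (H a).natDegree * 1 := Nat.mul_le_mul_left _ h1
      _ ≤ D := by have := hHd a ha; omega
  have hand : ∀ u ∈ signedPowers (k / 2 + 1), ∀ v ∈ signedPowers (k / 2 + 1),
      ∀ v₁ v₂ : Cube (Fin (n + n)),
      halfspaceValue (fun i => (w i : ℕ)) (2 ^ (k + 1)) v₁ = ζ u →
      halfspaceValue (fun i => (w i : ℕ)) (2 ^ (k + 1)) v₂ = ζ v →
      SignType.sign (MvPolynomial.eval (Cube.toReal (Sum.elim v₁ v₂)) p)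
        = if u < 0 ∧ v < 0 then -1 else 1 := by
    intro u hu v hv v₁ v₂ h1 h2
    have hlt : ∀ u ∈ signedPowers (k / 2 + 1), (ζ u < 0 ↔ u < 0) := by
      intro u hu
      have h3 := hζ u hu
      constructor
      · intro h
        have : (ζ u : ℝ) ≤ -1 := by exact_mod_cast Int.le_sub_one_of_lt h
        linarith
      · intro h
        have : (ζ u : ℝ) < 0 := by linarith
        exact_mod_cast this
    have h4 := hsign (Sum.elim v₁ v₂)
    rw [← h4, andDisjoint]
    simp only [Sum.elim_inl, Sum.elim_inr]
    rw [weightedHalfspace_eq_ite, weightedHalfspace_eq_ite, h1, h2, andSign]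
    by_cases hu0 : u < 0 <;> by_cases hv0 : v < 0 <;> simp [hlt u hu, hlt v hv, hu0, hv0]
  refine scales_le_of_quadrant_sign (k / 2 + 1) D P ?_ ?_ ?_ ?_
  · intro v hv
    refine ⟨∑ s ∈ p.support, Polynomial.C (p.coeff s * N (ζ v) (mon fun i => s (Sum.inr i))) *
      (H fun i => s (Sum.inl i)).comp (Polynomial.C (1 / 2) * (Polynomial.X - 1)), ?_, ?_⟩
    · refine Polynomial.natDegree_sum_le_of_forall_le _ _ fun s hs => ?_
      exact (Polynomial.natDegree_C_mul_le _ _).trans (hcomp _ (hdeg s hs).1)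
    · intro u hu
      rw [hP, Polynomial.eval_finsetSum]
      refine Finset.sum_congr rfl fun s hs => ?_
      rw [Polynomial.eval_mul, Polynomial.eval_C, ← hNH u hu _ (hdeg s hs).1]
      ring
  · intro u hu
    refine ⟨∑ s ∈ p.support, Polynomial.C (p.coeff s * N (ζ u) (mon fun i => s (Sum.inl i))) *
      (H fun i => s (Sum.inr i)).comp (Polynomial.C (1 / 2) * (Polynomial.X - 1)), ?_, ?_⟩
    · refine Polynomial.natDegree_sum_le_of_forall_le _ _ fun s hs => ?_
      exact (Polynomial.natDegree_C_mul_le _ _).trans (hcomp _ (hdeg s hs).2)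
    · intro v hv
      rw [hP, Polynomial.eval_finsetSum]
      refine Finset.sum_congr rfl fun s hs => ?_
      rw [Polynomial.eval_mul, Polynomial.eval_C, ← hNH v hv _ (hdeg s hs).2]
      ring
  · intro u hu v hv hu0 hv0
    have h1 : 0 < N (ζ u) (-fun v₁ => N (ζ v)
        fun v₂ => MvPolynomial.eval (Cube.toReal (Sum.elim v₁ v₂)) p) := by
      refine hpos _ (hζl u hu) (hζu u hu) _ fun v₁ hv₁ => ?_
      have h2 : 0 < N (ζ v) (-fun v₂ => MvPolynomial.eval (Cube.toReal (Sum.elim v₁ v₂)) p) := by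
        refine hpos _ (hζl v hv) (hζu v hv) _ fun v₂ hv₂ => ?_
        have h3 := hand u hu v hv v₁ v₂ hv₁ hv₂
        rw [if_pos ⟨hu0, hv0⟩, sign_eq_neg_one_iff] at h3
        simpa using h3
      rwa [map_neg] at h2
    rw [map_neg] at h1
    exact neg_pos.mp h1
  · intro u hu v hv huv
    refine hpos _ (hζl u hu) (hζu u hu) _ fun v₁ hv₁ => hpos _ (hζl v hv) (hζu v hv) _ fun v₂ hv₂ => ?_
    have h3 := hand u hu v hv v₁ v₂ hv₁ hv₂
    rw [if_neg (by rintro ⟨h4, h5⟩; rcases huv with h | h <;> linarith), sign_eq_one_iff] at h3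
    exact h3

/-! ### Probability estimates -/

/-- Weight each set by `(1 / 100) ^ S.card`: the total is `(101 / 100) ^ n`, and each small set
weighs at least `100 ^ (-s)`. -/
theorem card_filter_card_le_le (n s : ℕ) :
    ((Finset.univ.filter fun S : Finset (Fin n) => S.card ≤ s).card : ℝ)
      ≤ 100 ^ s * (101 / 100) ^ n := by
  have h1 : ∑ S : Finset (Fin n), (1 / 100 : ℝ) ^ S.card = (101 / 100) ^ n := by
    have := Fintype.sum_pow_mul_eq_add_pow (Fin n) (1 / 100 : ℝ) 1
    simp only [one_pow, mul_one, Fintype.card_fin] at this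
    rw [this]
    norm_num
  rw [← h1, Finset.mul_sum, Finset.card_eq_sum_ones, Finset.sum_filter, Nat.cast_sum]
  refine Finset.sum_le_sum fun S _ => ?_
  split_ifs with h
  · have : (100 : ℝ) ^ s = 100 ^ (s - S.card) * 100 ^ S.card := by
      rw [← pow_add]
      congr 1
      omega
    rw [this, mul_assoc, ← mul_pow]
    norm_num
    exact one_le_pow₀ (by norm_num)
  · simp only [Nat.cast_zero]
    positivity

theorem failure_probability_le {n k D : ℕ} (hk : 30 * k ≤ n) (hD : 1000 * D ≤ n) (hn : 1000 ≤ n)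
    {K M : ℝ} (hK : K ≤ 100 ^ (2 * D) * (101 / 100) ^ n) (hK0 : 0 ≤ K) (hM : M = 2 ^ (k + 1)) :
    16 * M ^ 3 * K ^ 3 ≤ Real.exp (-(n : ℝ) / 3) * 2 ^ n := by
  have he : (2.7182818283 : ℝ) < Real.exp 1 := Real.exp_one_gt_d9
  have hpow : ∀ j : ℕ, Real.exp j = Real.exp 1 ^ j := fun j => by
    rw [← Real.exp_nat_mul, mul_one]
  have h16 : (16 : ℝ) ≤ Real.exp 3 := by
    have := hpow 3
    push_cast at this
    rw [this]
    calc (16 : ℝ) ≤ 2.7182818283 ^ 3 := by norm_num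
      _ ≤ _ := pow_le_pow_left₀ (by norm_num) he.le 3
  have h100 : (100 : ℝ) ≤ Real.exp 5 := by
    have := hpow 5
    push_cast at this
    rw [this]
    calc (100 : ℝ) ≤ 2.7182818283 ^ 5 := by norm_num
      _ ≤ _ := pow_le_pow_left₀ (by norm_num) he.le 5
  have h101 : (101 / 100 : ℝ) ≤ Real.exp (1 / 100) := by
    have := Real.add_one_le_exp (1 / 100 : ℝ)
    linarith
  have h2 : (2 : ℝ) ≤ Real.exp (7 / 10) := by
    rw [← Real.log_le_iff_le_exp (by norm_num)]
    linarith [Real.log_two_lt_d9]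
  have h2' : Real.exp (69 / 100) ≤ 2 := by
    rw [← Real.le_log_iff_exp_le (by norm_num)]
    linarith [Real.log_two_gt_d9]
  have hM' : M ≤ Real.exp ((k + 1 : ℕ) * (7 / 10)) := by
    rw [hM, Real.exp_nat_mul]
    exact pow_le_pow_left₀ (by norm_num) h2 _
  have hK' : K ≤ Real.exp ((2 * D : ℕ) * 5 + n * (1 / 100)) := by
    refine hK.trans ?_
    rw [Real.exp_add, Real.exp_nat_mul, Real.exp_nat_mul]
    gcongr
  have hM0 : 0 ≤ M := by rw [hM]; positivity
  calc 16 * M ^ 3 * K ^ 3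
      ≤ Real.exp 3 * Real.exp ((k + 1 : ℕ) * (7 / 10)) ^ 3
        * Real.exp ((2 * D : ℕ) * 5 + n * (1 / 100)) ^ 3 := by gcongr
    _ = Real.exp (3 + (3 : ℕ) * ((k + 1 : ℕ) * (7 / 10))
        + (3 : ℕ) * ((2 * D : ℕ) * 5 + n * (1 / 100))) := by
        rw [← Real.exp_nat_mul, ← Real.exp_nat_mul, ← Real.exp_add, ← Real.exp_add]
    -- The left exponent is `5.1 + 2.1 * k + 30 * D + 0.03 * n`, at most `0.13 * n + 5.1`, against
    -- more than `0.35 * n` on the right.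
    _ ≤ Real.exp (-(n : ℝ) / 3 + n * (69 / 100)) := by
        refine Real.exp_le_exp.mpr ?_
        have h3 : 30 * (k : ℝ) ≤ n := by exact_mod_cast hk
        have h4 : 1000 * (D : ℝ) ≤ n := by exact_mod_cast hD
        have h5 : (1000 : ℝ) ≤ n := by exact_mod_cast hn
        push_cast
        linarith
    _ ≤ Real.exp (-(n : ℝ) / 3) * 2 ^ n := by
        rw [Real.exp_add, Real.exp_nat_mul]
        gcongr

open Classical in
theorem one_sub_le_uniformOn_real {Ω : Type} [Fintype Ω] [Nonempty Ω] [MeasurableSpace Ω]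
    [MeasurableSingletonClass Ω] {δ : ℝ} (s : Set Ω)
    (h : ((Finset.univ.filter fun w => w ∉ s).card : ℝ) ≤ δ * Fintype.card Ω) :
    1 - δ ≤ (ProbabilityTheory.uniformOn (Set.univ : Set Ω)).real s := by
  have hs : (ProbabilityTheory.uniformOn (Set.univ : Set Ω)).real s
      = ((Finset.univ.filter fun w => w ∈ s).card : ℝ) / Fintype.card Ω := by
    rw [MeasureTheory.measureReal_def, ProbabilityTheory.uniformOn_univ, ENNReal.toReal_div]
    congr 1
    have : s = ((Finset.univ.filter fun w => w ∈ s : Finset Ω) : Set Ω) := by ext; simp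
    conv_lhs => rw [this]
    rw [MeasureTheory.Measure.count_apply_finset]
    simp
  have hcard : ((Finset.univ.filter fun w => w ∈ s).card : ℝ)
      + ((Finset.univ.filter fun w => w ∉ s).card : ℝ) = Fintype.card Ω := by
    have := Finset.card_filter_add_card_filter_not (s := (Finset.univ : Finset Ω)) (· ∈ s)
    exact_mod_cast this
  have hpos : (0 : ℝ) < Fintype.card Ω := by exact_mod_cast Fintype.card_pos
  rw [hs, le_div_iff₀ hpos]
  linarith

theorem lt_thresholdDegree_of_walshEquidistributed {n k D : ℕ} (hn : 0 < n)
    (w : Fin n → Fin (2 ^ (k + 1))) {lam : ℝ} (hlam : 0 ≤ lam)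
    (hw : WalshEquidistributed (fun i => ((w i : ℕ) : ZMod (2 ^ (k + 1)))) (2 * D) lam)
    (hbig : (2 * ((Finset.univ.filter fun S : Finset (Fin n) => S.card ≤ D).card : ℝ) + 1) * lam
      < Fintype.card (Cube (Fin n)) / Fintype.card (ZMod (2 ^ (k + 1))))
    (hD : 32 * D < k / 2 + 1) :
    D < thresholdDegree (andDisjoint (weightedHalfspace n k w) (weightedHalfspace n k w)) := by
  obtain ⟨c, h0, h1, h2, h3⟩ := hw.exists_weights hlam hbig
  by_contra hle
  obtain ⟨p, hp, hsign⟩ := exists_signRepresents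
    (andDisjoint (weightedHalfspace n k w) (weightedHalfspace n k w))
  have := scales_le_of_signRepresents hn w c h0 h1 h2 h3 p (by omega) hsign
  omega

theorem card_thresholdDegree_lt_le {n k D : ℕ} (hk : 30 * k ≤ n) (hD : 1000 * D ≤ n)
    (hn : 1000 ≤ n) (hDk : 32 * D < k / 2 + 1) :
    ((Finset.univ.filter fun w : Fin n → Fin (2 ^ (k + 1)) =>
      ¬ D ≤ thresholdDegree (andDisjoint (weightedHalfspace n k w)
        (weightedHalfspace n k w))).card : ℝ)
      ≤ Real.exp (-(n : ℝ) / 3) * Fintype.card (Fin n → Fin (2 ^ (k + 1))) := by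
  classical
  set K : ℝ := ((Finset.univ.filter fun S : Finset (Fin n) => S.card ≤ 2 * D).card : ℝ) with hK
  set M : ℝ := 2 ^ (k + 1) with hM
  have hM0 : 0 < M := by positivity
  have hK1 : 1 ≤ K := by
    rw [hK]
    exact_mod_cast Finset.card_pos.mpr ⟨∅, by simp⟩
  have hcube : (Fintype.card (Cube (Fin n)) : ℝ) = 2 ^ n := by simp
  have hA : (Fintype.card (ZMod (2 ^ (k + 1))) : ℝ) = M := by simp [hM, ZMod.card]
  -- A `1 / (4 * K)` fraction of the mean fibre size `2 ^ n / M`: small enough for the duality step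
  -- since `2 * K + 1 < 4 * K`, and giving failure probability at most `16 * M ^ 3 * K ^ 3 / 2 ^ n`.
  set lam : ℝ := 2 ^ n / (M * (4 * K)) with hlam
  have hlam0 : 0 < lam := by positivity
  let toZ : (Fin n → Fin (2 ^ (k + 1))) → Fin n → ZMod (2 ^ (k + 1)) :=
    fun w i => ((w i : ℕ) : ZMod (2 ^ (k + 1)))
  have hinj : Function.Injective toZ := by
    intro w w' h
    funext i
    have h1 := congrFun h i
    simp only [toZ] at h1
    rw [ZMod.natCast_eq_natCast_iff'] at h1
    rw [Nat.mod_eq_of_lt (w i).isLt, Nat.mod_eq_of_lt (w' i).isLt] at h1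
    exact Fin.ext h1
  have hcard : Fintype.card (Fin n → Fin (2 ^ (k + 1)))
      = Fintype.card (Fin n → ZMod (2 ^ (k + 1))) := by
    simp [ZMod.card]
  have hle : ((Finset.univ.filter fun w : Fin n → Fin (2 ^ (k + 1)) =>
      ¬ D ≤ thresholdDegree (andDisjoint (weightedHalfspace n k w)
        (weightedHalfspace n k w))).card : ℝ)
      ≤ ((Finset.univ.filter fun w : Fin n → ZMod (2 ^ (k + 1)) =>
        ¬ WalshEquidistributed w (2 * D) lam).card : ℝ) := by
    norm_cast
    refine Finset.card_le_card_of_injOn toZ ?_ hinj.injOn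
    intro w hw
    simp only [Finset.coe_filter, Finset.mem_univ, true_and, Set.mem_ofPred_eq] at hw ⊢
    refine fun hgood => hw (lt_thresholdDegree_of_walshEquidistributed (by omega) w hlam0.le hgood
      ?_ hDk).le
    rw [hcube, hA, hlam]
    have hKD : ((Finset.univ.filter fun S : Finset (Fin n) => S.card ≤ D).card : ℝ) ≤ K := by
      rw [hK]
      norm_cast
      refine Finset.card_le_card fun S hS => ?_
      simp only [Finset.mem_filter, Finset.mem_univ, true_and] at hS ⊢
      omega
    have h2 : (2 : ℝ) ^ n / M = (4 * K) * (2 ^ n / (M * (4 * K))) := by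
      field_simp
    rw [h2]
    exact mul_lt_mul_of_pos_right (by linarith) hlam0
  refine hle.trans ?_
  have hbad := card_not_walshEquidistributed_le (ι := Fin n) (A := ZMod (2 ^ (k + 1))) (2 * D)
    hlam0.le
  rw [hcube, hA, ← hcard] at hbad
  have hfail := failure_probability_le hk hD hn (card_filter_card_le_le n (2 * D))
    (by positivity) hM
  rw [← hK] at hfail hbad
  rw [← le_div_iff₀ (by positivity)] at hbad
  refine hbad.trans ?_
  have h2n : (0 : ℝ) < 2 ^ n := by positivity
  rw [hlam, div_pow, div_div_eq_mul_div, div_le_iff₀ (by positivity)]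
  calc M * K * ((Fintype.card (Fin n → Fin (2 ^ (k + 1))) : ℝ) * 2 ^ n) * (M * (4 * K)) ^ 2
      = (16 * M ^ 3 * K ^ 3) * (Fintype.card (Fin n → Fin (2 ^ (k + 1))) * 2 ^ n) := by ring
    _ ≤ (Real.exp (-(n : ℝ) / 3) * 2 ^ n) *
          (Fintype.card (Fin n → Fin (2 ^ (k + 1))) * 2 ^ n) :=
        mul_le_mul_of_nonneg_right hfail (by positivity)
    _ = _ := by ring

/-- For random weights the conjunction has linear threshold degree with overwhelming probability. -/
theorem one_sub_exp_le_uniformOn_thresholdDegree {α β : ℝ} (hα : 0 < α) (hα' : α ≤ 1 / 30)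
    (hβ : 0 < β) (hβ' : β ≤ α / 64) (n : ℕ) :
    1 - Real.exp (-(n : ℝ) / 3) ≤
      (ProbabilityTheory.uniformOn
        (Set.univ : Set (Fin n → Fin (2 ^ (⌊α * n⌋₊ + 1))))).real
        {w | ⌊β * n⌋₊ ≤ thresholdDegree
          (andDisjoint (weightedHalfspace n ⌊α * n⌋₊ w) (weightedHalfspace n ⌊α * n⌋₊ w))} := by
  classical
  have hn0 : (0 : ℝ) ≤ n := n.cast_nonneg
  have hDβ : (⌊β * n⌋₊ : ℝ) ≤ β * n := Nat.floor_le (by positivity)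
  have hkα : (⌊α * n⌋₊ : ℝ) ≤ α * n := Nat.floor_le (by positivity)
  have hkα' : α * n < ⌊α * n⌋₊ + 1 := Nat.lt_floor_add_one _
  generalize ⌊β * n⌋₊ = D at *
  generalize ⌊α * n⌋₊ = k at *
  refine one_sub_le_uniformOn_real _ ?_
  -- For `D = 0` nothing can fail. Otherwise `1 ≤ D ≤ n / 1920` forces `n` to be large, as the
  -- numerical estimate needs.
  rcases Nat.eq_zero_or_pos D with rfl | hD
  · simp only [zero_le, Set.ofPred_true, Set.mem_univ, not_true_eq_false, Finset.filter_false,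
      Finset.card_empty, Nat.cast_zero]
    positivity
  · have hD1 : (1 : ℝ) ≤ D := by exact_mod_cast hD
    have h1 : 1000 * D ≤ n := by
      have : 1000 * (D : ℝ) ≤ n := by nlinarith
      exact_mod_cast this
    have h2 : 30 * k ≤ n := by
      have : 30 * (k : ℝ) ≤ n := by nlinarith
      exact_mod_cast this
    have h4 : 64 * D < k + 1 := by
      have h3 : (64 : ℝ) * D < k + 1 := by nlinarith
      exact_mod_cast h3
    have hmain := card_thresholdDegree_lt_le h2 h1 (by omega) (by omega)
    simp only [Set.mem_ofPred_eq]
    convert hmain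

/-! ### Bounds for the maximum degree `D(n)` -/

theorem isHalfspace_weightedHalfspace (n k : ℕ) (w : Fin n → Fin (2 ^ (k + 1))) :
    IsHalfspace (weightedHalfspace n k w) := by
  refine ⟨fun x => ?_, Fin.append (fun i => ((w i : ℕ) : ℝ)) (fun _ => -2 ^ (k + 1)), -(1 / 2),
    fun x => ?_⟩
  · rw [weightedHalfspace_eq_ite]
    split_ifs <;> simp
  · rw [weightedHalfspace, Fin.sum_univ_add]
    simp only [Fin.append_left, Fin.append_right, ← Finset.mul_sum]
    congr 1
    ring

/-- Halfspaces stay halfspaces when their variables are renamed. -/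
theorem IsHalfspace.comp {ι κ : Type} [Fintype ι] [Fintype κ] {F : Cube ι → SignType}
    (hF : IsHalfspace F) (e : ι → κ) : IsHalfspace fun z : Cube κ => F fun i => z (e i) := by
  classical
  obtain ⟨h, a, θ, ha⟩ := hF
  refine ⟨fun z => h _, fun j => ∑ i, if e i = j then a i else 0, θ, fun z => ?_⟩
  have hsum : ∑ j, (∑ i, if e i = j then a i else 0) * z.toReal j
      = ∑ i, a i * z.toReal (e i) := by
    simp only [Finset.sum_mul]
    rw [Finset.sum_comm]
    refine Finset.sum_congr rfl fun i _ => ?_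
    simp [ite_mul]
  dsimp only
  rw [ha, hsum]
  rfl

theorem thresholdDegree_le_of_signRepresents {ι : Type} {f : Cube ι → SignType}
    {p : MvPolynomial ι ℝ} (h : SignRepresents p f) : thresholdDegree f ≤ p.totalDegree :=
  Nat.sInf_le ⟨p, rfl, h⟩

/-- Identifying variables does not increase the threshold degree. -/
theorem thresholdDegree_comp_le {ι κ : Type} [Fintype ι] (f : Cube ι → SignType) (r : ι → κ) :
    thresholdDegree (fun z : Cube κ => f fun i => z (r i)) ≤ thresholdDegree f := by
  obtain ⟨p, hp, hsign⟩ := exists_signRepresents f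
  rw [← hp]
  refine le_trans (thresholdDegree_le_of_signRepresents (p := MvPolynomial.rename r p) ?_)
    (MvPolynomial.totalDegree_rename_le r p)
  intro z
  dsimp only
  rw [hsign, MvPolynomial.eval_rename]
  rfl

/-- Positive powers of a 0/1 coordinate collapse to the coordinate itself, so a representation can
be taken multilinear. -/
theorem thresholdDegree_le_card {ι : Type} [Fintype ι] (f : Cube ι → SignType) :
    thresholdDegree f ≤ Fintype.card ι := by
  obtain ⟨p, -, hsign⟩ := exists_signRepresents f
  let q : MvPolynomial ι ℝ := ∑ s ∈ p.support, MvPolynomial.C (p.coeff s) *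
    ∏ i ∈ s.support, MvPolynomial.X i
  have hq : SignRepresents q f := by
    intro x
    rw [hsign, MvPolynomial.eval_eq]
    simp only [q, map_sum, map_mul, map_prod, MvPolynomial.eval_C, MvPolynomial.eval_X]
    congr 1
    refine Finset.sum_congr rfl fun s _ => ?_
    rw [Finset.prod_congr rfl fun i hi => x.toReal_pow i (Finsupp.mem_support_iff.mp hi)]
  refine (thresholdDegree_le_of_signRepresents hq).trans ?_
  refine (MvPolynomial.totalDegree_finsetSum _ _).trans (Finset.sup_le fun s _ => ?_)
  refine (MvPolynomial.totalDegree_mul _ _).trans ?_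
  rw [MvPolynomial.totalDegree_C, zero_add]
  refine (MvPolynomial.totalDegree_finsetProd _ _).trans ?_
  simp only [MvPolynomial.totalDegree_X, Finset.sum_const, smul_eq_mul, mul_one]
  exact s.support.card_le_univ

theorem maxIntersectionDegree_le (n : ℕ) : maxIntersectionDegree n ≤ n := by
  obtain ⟨f, g, -, -, h⟩ := (maxIntersectionDegree_isGreatest n).1
  rw [h]
  simpa using thresholdDegree_le_card (andSame f g)

theorem one_le_maxIntersectionDegree {n : ℕ} (hn : 1 ≤ n) : 1 ≤ maxIntersectionDegree n := by
  let i : Fin n := ⟨0, hn⟩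
  let f : Cube (Fin n) → SignType := fun x => if x i = 1 then -1 else 1
  have hf : IsHalfspace f := by
    refine ⟨fun x => ?_, Pi.single i (-1), -(1 / 2), fun x => ?_⟩
    · by_cases h : x i = 1 <;> simp [f, h]
    · rw [Finset.sum_eq_single i (fun j _ hj => by rw [Pi.single_eq_of_ne hj, zero_mul]) (by simp),
        Pi.single_eq_same]
      rcases fin_two_eq_zero_or_one (x i) with h | h
      · rw [sign_pos (by simp [Cube.toReal, h])]
        simp [f, h]
      · rw [sign_neg (by simp [Cube.toReal, h]; norm_num)]
        simp [f, h]
  refine le_trans ?_ ((maxIntersectionDegree_isGreatest n).2 ⟨f, f, hf, hf, rfl⟩)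
  by_contra hlt
  obtain ⟨p, hp, hsign⟩ := exists_signRepresents (andSame f f)
  obtain ⟨a, rfl⟩ : ∃ a, p = MvPolynomial.C a :=
    ⟨_, MvPolynomial.totalDegree_eq_zero_iff_eq_C.mp (by omega)⟩
  have h0 := hsign fun _ => 0
  have h1 := hsign fun _ => 1
  rw [MvPolynomial.eval_C] at h0 h1
  rw [← h1] at h0
  simp [andSame, andSign, f] at h0

theorem thresholdDegree_andDisjoint_le_maxIntersectionDegree {m n : ℕ} (hm : 0 < m)
    (hmn : 2 * m ≤ n) {F G : Cube (Fin m) → SignType} (hF : IsHalfspace F) (hG : IsHalfspace G) :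
    thresholdDegree (andDisjoint F G) ≤ maxIntersectionDegree n := by
  obtain ⟨e⟩ : Nonempty (Fin m ⊕ Fin m ↪ Fin n) :=
    Function.Embedding.nonempty_of_card_le (by simp; omega)
  have : Nonempty (Fin m ⊕ Fin m) := ⟨Sum.inl ⟨0, hm⟩⟩
  refine le_trans ?_ ((maxIntersectionDegree_isGreatest n).2
    ⟨_, _, hF.comp fun i => e (Sum.inl i), hG.comp fun i => e (Sum.inr i), rfl⟩)
  -- Pulling back along a left inverse of `e` recovers the disjoint conjunction, so the embedding
  -- loses no threshold degree.
  refine le_trans (le_of_eq ?_) (thresholdDegree_comp_le _ (Function.invFun e))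
  congr 1
  funext z
  simp only [andDisjoint, andSame, Function.leftInverse_invFun e.injective _]

theorem exists_linear_le_maxIntersectionDegree :
    ∃ c : ℝ, 0 < c ∧ ∀ n : ℕ, 1 ≤ n → c * n ≤ maxIntersectionDegree n := by
  -- This is `α / 64` at `α = 1 / 30`. The slack 16 covers the four blocks of size `n / 4` and the
  -- two roundings; when `β / 16 * n < 1` a nonconstant conjunction suffices.
  set β : ℝ := 1 / 1920 with hβ
  refine ⟨β / 16, by positivity, fun n hn => ?_⟩
  rcases lt_or_ge (β / 16 * n) 1 with hlt | hge
  · have h1 : (1 : ℝ) ≤ maxIntersectionDegree n := by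
      exact_mod_cast one_le_maxIntersectionDegree hn
    linarith
  · set m := n / 4 with hm
    have hm4 : n < 4 * m + 4 := by omega
    have hmR : (n : ℝ) < 4 * m + 4 := by exact_mod_cast hm4
    have hm0 : 0 < m := by
      have : (0 : ℝ) < m := by nlinarith
      exact_mod_cast this
    have hprob := one_sub_exp_le_uniformOn_thresholdDegree (α := 1 / 30) (β := β) (by norm_num)
      le_rfl (by norm_num) (by norm_num) m
    have hexp : Real.exp (-(m : ℝ) / 3) < 1 := by
      rw [Real.exp_lt_one_iff]
      have : (0 : ℝ) < m := by exact_mod_cast hm0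
      linarith
    obtain ⟨w, hw⟩ : {w | ⌊β * m⌋₊ ≤ thresholdDegree
        (andDisjoint (weightedHalfspace m ⌊(1 / 30 : ℝ) * m⌋₊ w)
          -- Positive probability yields a concrete good weight vector.
          (weightedHalfspace m ⌊(1 / 30 : ℝ) * m⌋₊ w))}.Nonempty := by
      rw [Set.nonempty_iff_ne_empty]
      intro hempty
      rw [hempty, MeasureTheory.measureReal_empty] at hprob
      linarith
    have h1 : ⌊β * m⌋₊ ≤ maxIntersectionDegree n :=
      le_trans hw (thresholdDegree_andDisjoint_le_maxIntersectionDegree (by omega) (by omega)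
        (isHalfspace_weightedHalfspace _ _ w) (isHalfspace_weightedHalfspace _ _ w))
    have h2 : β * m < ⌊β * m⌋₊ + 1 := Nat.lt_floor_add_one _
    have h3 : (⌊β * m⌋₊ : ℝ) ≤ maxIntersectionDegree n := by exact_mod_cast h1
    rw [hβ] at h2 hge h3 ⊢
    linarith

theorem theorem1p1 :
    (∃ c C : ℝ, 0 < c ∧ 0 < C ∧ ∀ n : ℕ, 1 ≤ n →
      c * n ≤ (maxIntersectionDegree n : ℝ) ∧ (maxIntersectionDegree n : ℝ) ≤ C * n) ∧
    (∃ α₀ : ℝ, 0 < α₀ ∧ ∀ α : ℝ, 0 < α → α ≤ α₀ →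
      ∃ β₀ : ℝ, 0 < β₀ ∧ ∀ β : ℝ, 0 < β → β ≤ β₀ → ∀ n : ℕ, 1 ≤ n →
        1 - Real.exp (-(n : ℝ) / 3) ≤
          (ProbabilityTheory.uniformOn
            (Set.univ : Set (Fin n → Fin (2 ^ (⌊α * n⌋₊ + 1))))).real
            {w | ⌊β * n⌋₊ ≤ thresholdDegree
              (andDisjoint (weightedHalfspace n ⌊α * n⌋₊ w)
                (weightedHalfspace n ⌊α * n⌋₊ w))}) := by
  refine ⟨?_, 1 / 30, by norm_num, fun α hα hα' => ⟨α / 64, by positivity,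
    fun β hβ hβ' n _ => one_sub_exp_le_uniformOn_thresholdDegree hα hα' hβ hβ' n⟩⟩
  obtain ⟨c, hc, h⟩ := exists_linear_le_maxIntersectionDegree
  refine ⟨c, 1, hc, one_pos, fun n hn => ⟨h n hn, ?_⟩⟩
  rw [one_mul]
  exact_mod_cast maxIntersectionDegree_le n
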